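/- A directed multigraph $G=(V,E,\Gamma)$ consists of a finite node set $V$, an edge set $E\subseteq V\times V$ without self-loops, and multiplicities $\Gamma:E\to\{1,2,\dots\}$. For a node $v$, let $\delta^+_G(v)$ be the set of edges $(v,w)\in E$ and let $\Delta^+_G(v)$ and $\Delta^-_G(v)$ be the sums of the multiplicities of the edges leaving and entering $v$. An $r$-Eulerian cycle is a sequence of consecutive edges that starts and ends at $r$ and contains every $e\in E$ exactly $\Gamma(e)$ times. A $t$-oriented spanning tree of $G$ is a set $E'\subseteq E$ such that every $v\in V$ has exactly one path to $t$ in $(V,E')$; $\mathcal T_G(t)$ is the set of all of them. An instance $(G,F,r)$ consists of a directed multigraph $G$, a set $F\subseteq E$ of priority edges with $|F\cap\delta^+_G(v)|\le 1$ for all $v$ and $\Gamma(e)=1$ for all $e\in F$, and a node $r\in V$. An $r$-ECP is an $r$-Eulerian cycle $p$ that respects $F$: for each $(u,w)\in F$, no edge with tail $u$ occurs in $p$ before $(u,w)$. Let $G'=(V,E\setminus F,\Gamma')$ be $G$ with the priority edges removed, where $\Gamma'$ is the restriction of $\Gamma$. **Theorem.** 1. The number of $r$-ECPs of $(G,F,r)$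 can be computed in time polynomial in $|V|+\sum_{e\in E}\Gamma(e)$, that is, in the number of nodes plus the number of edges counted with multiplicity. (The model is a random access machine with integer arithmetic and logarithmic cost.) 2. If $\Delta^-_G(v)=\Delta^+_G(v)$ for all $v\in V$, and every node is the tail of at least one edge of $E\setminus F$, then the number of $r$-ECPs is $$\Delta^{+}_{G'}(r)\cdot\prod_{v\in V}\frac{(\Delta^{+}_{G'}(v)-1)!}{\prod_{e\in\delta^{+}_{G'}(v)}\Gamma'(e)!}\cdot\sum_{E'\in\mathcal T_{G'}(r)}\ \prod_{e\in E'}\Gamma'(e).$$ If $\Delta^-_G(v)\ne\Delta^+_G(v)$ for some $v\in V$, then there is no $r$-ECP. 3. The last sum equals the determinant of the matrix $L$ without the row and the column of $r$, where $L_{vv}=\Delta^+_{G'}(v)$, $L_{uv}=-\Gamma'((u,v))$ if $(u,v)\in E\setminus F$, and $L_{uv}=0$ for all other $u\neq v$. -/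

import Mathlib

namespace ECP

/-! ### Directed multigraphs, paths, Eulerian cycles -/

/-- A directed multigraph without self-loops on the node set `V`. The number `mult (u, v)` is the
multiplicity of the edge `(u, v)`; it is `0` exactly when `(u, v)` is not an edge. -/
structure DirectedMultigraph (V : Type*) where
  mult : V × V → ℕ
  loopless : ∀ v, mult (v, v) = 0

/-- `IsPath E u p w`: the sequence `p` of edges from `E` is a `u`--`w` path. Nodes and edges may be
repeated, and the empty sequence is a `u`--`u` path. -/
def IsPath {V : Type*} (E : Finset (V × V)) : V → List (V × V) → V → Prop
  | u, [], w => u = w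
  | u, e :: p, w => e ∈ E ∧ e.1 = u ∧ IsPath E e.2 p w

/-- `(V, T)` is a `t`-oriented tree: every node has exactly one path to `t`. -/
def IsOrientedTree {V : Type*} (T : Finset (V × V)) (t : V) : Prop :=
  ∀ v, ∃! p, IsPath T v p t

namespace DirectedMultigraph

variable {V : Type*} [Fintype V] [DecidableEq V] (G : DirectedMultigraph V)

/-- The edge set. -/
def edges : Finset (V × V) := Finset.univ.filter fun e => 0 < G.mult e

/-- The edges with tail `v`. -/
def outEdges (v : V) : Finset (V × V) := G.edges.filter fun e => e.1 = v

/-- The edges with head `v`. -/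
def inEdges (v : V) : Finset (V × V) := G.edges.filter fun e => e.2 = v

/-- Out-degree, with multiplicities. -/
def outDegree (v : V) : ℕ := ∑ e ∈ G.outEdges v, G.mult e

/-- In-degree, with multiplicities. -/
def inDegree (v : V) : ℕ := ∑ e ∈ G.inEdges v, G.mult e

/-- Every node has equal in- and out-degree. -/
def Balanced : Prop := ∀ v, G.inDegree v = G.outDegree v

/-- `p` is an Eulerian cycle from `r` to `r`: it contains each edge as often as its multiplicity
says. -/
def IsEulerianCycle (r : V) (p : List (V × V)) : Prop :=
  IsPath G.edges r p r ∧ ∀ e ∈ G.edges, p.count e = G.mult e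

/-- The multigraph without the edges in `F`; the other multiplicities are unchanged. -/
def deleteEdges (F : Finset (V × V)) : DirectedMultigraph V where
  mult e := if e ∈ F then 0 else G.mult e
  loopless v := by simp [G.loopless v]

open Classical in
/-- The (edge sets of the) `t`-oriented spanning trees. -/
noncomputable def orientedSpanningTrees (t : V) : Finset (Finset (V × V)) :=
  G.edges.powerset.filter fun T => IsOrientedTree T t

/-- The number of `t`-oriented spanning trees, each weighted by the product of its
multiplicities. -/
noncomputable def weightedTreeCount (t : V) : ℕ :=
  ∑ T ∈ G.orientedSpanningTrees t, ∏ e ∈ T, G.mult e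

/-- The out-degree Laplacian. -/
def laplacian : Matrix V V ℤ := Matrix.of fun u v =>
  if u = v then (G.outDegree u : ℤ) else -(G.mult (u, v) : ℤ)

/-- The out-degree Laplacian without the row and the column of `r`. -/
def reducedLaplacian (r : V) : Matrix {v // v ≠ r} {v // v ≠ r} ℤ :=
  G.laplacian.submatrix Subtype.val Subtype.val

end DirectedMultigraph

/-! ### Eulerian cycles with priority edges -/

/-- `p` respects the priority edges `F`: no edge with the tail of `f ∈ F` occurs in `p` before
`f`. -/
def Respects {V : Type*} (F : Finset (V × V)) (p : List (V × V)) : Prop :=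
  ∀ f ∈ F, ∀ p₁ p₂, p = p₁ ++ f :: p₂ → ∀ e ∈ p₁, e.1 ≠ f.1

/-- An instance of the problem: a directed multigraph, a set of priority edges, each of
multiplicity one and at most one per tail, and a start node. -/
structure Instance (V : Type*) [Fintype V] [DecidableEq V] where
  graph : DirectedMultigraph V
  priority : Finset (V × V)
  start : V
  priority_subset : priority ⊆ graph.edges
  priority_card_le : ∀ v, (priority ∩ graph.outEdges v).card ≤ 1
  priority_mult : ∀ e ∈ priority, graph.mult e = 1

namespace Instance

variable {V : Type*} [Fintype V] [DecidableEq V] (I : Instance V)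

/-- The solutions: the Eulerian cycles from the start node that respect the priority edges. -/
def solutions : Set (List (V × V)) :=
  {p | I.graph.IsEulerianCycle I.start p ∧ Respects I.priority p}

/-- The number of solutions. -/
noncomputable def count : ℕ := I.solutions.ncard

/-- The graph with the priority edges removed. -/
def residual : DirectedMultigraph V := I.graph.deleteEdges I.priority

/-- The size of the instance: the number of nodes plus the number of edges, counted with
multiplicity. -/
def size : ℕ := Fintype.card V + ∑ e ∈ I.graph.edges, I.graph.mult e

/-- The modified formula of the BEST theorem. -/
noncomputable def bestFormula : ℚ :=
  (I.residual.outDegree I.start : ℚ) *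
    (∏ v, ((I.residual.outDegree v - 1).factorial : ℚ) /
      ∏ e ∈ I.residual.outEdges v, ((I.residual.mult e).factorial : ℚ)) *
    (I.residual.weightedTreeCount I.start : ℚ)

/-- An instance on the nodes `0, …, n - 1` as a sequence of integers: the number `n`, the start
node, the `n × n` matrix of multiplicities and the 0/1 matrix of the priority edges, both row by
row. -/
def encode {n : ℕ} (I : Instance (Fin n)) : List ℤ :=
  [(n : ℤ), ((I.start : ℕ) : ℤ)] ++
    List.ofFn (fun i : Fin (n * n) => (I.graph.mult (finProdFinEquiv.symm i) : ℤ)) ++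
    List.ofFn (fun i : Fin (n * n) => if finProdFinEquiv.symm i ∈ I.priority then (1 : ℤ) else 0)

end Instance

theorem IsPath.subset {V : Type*} {E : Finset (V × V)} {u w : V} {p : List (V × V)}
    (h : IsPath E u p w) : ∀ e ∈ p, e ∈ E := by
  induction p generalizing u with
  | nil => simp
  | cons a p ih =>
    obtain ⟨ha, -, hp⟩ := h
    intro e he
    rcases List.mem_cons.1 he with rfl | he
    · exact ha
    · exact ih hp e he

/-- There are finitely many solutions, so that `Instance.count` counts them. -/
theorem Instance.solutions_finite {V : Type*} [Fintype V] [DecidableEq V] (I : Instance V) :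
    I.solutions.Finite := by
  refine (List.finite_length_eq (V × V) (∑ e ∈ I.graph.edges, I.graph.mult e)).subset ?_
  rintro p ⟨⟨hp, hc⟩, -⟩
  have h : (p : Multiset (V × V)).card = ∑ e ∈ I.graph.edges, (p : Multiset (V × V)).count e :=
    (Multiset.sum_count_eq_card fun e he => hp.subset e (by simpa using he)).symm
  simp only [Multiset.coe_card, Multiset.coe_count] at h
  have hl : p.length = ∑ e ∈ I.graph.edges, I.graph.mult e := by
    rw [h]
    refine Finset.sum_congr rfl fun e he => ?_
    rw [← hc e he]
    congr 1
    exact lawful_beq_subsingleton _ _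
  exact hl

/-! ### Random access machines with logarithmic cost

Programs work on integers of arbitrary size that are kept in registers and in arrays with indirect
addressing. Each elementary step costs one plus the binary lengths of the integers and addresses
that it handles. -/

/-- Contents of the registers and of the arrays. -/
structure Store where
  reg : ℕ → ℤ
  arr : ℕ → ℤ → ℤ

/-- The store with an input sequence in the cells `0, 1, 2, …` of array `0` and with `0`
everywhere else. -/
def Store.init (l : List ℤ) : Store where
  reg _ := 0
  arr a i := if a = 0 ∧ 0 ≤ i then l.getD i.toNat 0 else 0

/-- Assign `z` to register `x`. -/
def Store.setReg (s : Store) (x : ℕ) (z : ℤ) : Store where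
  reg := Function.update s.reg x z
  arr := s.arr

/-- Assign `z` to cell `i` of array `a`. -/
def Store.setArr (s : Store) (a : ℕ) (i z : ℤ) : Store where
  reg := s.reg
  arr := Function.update s.arr a (Function.update (s.arr a) i z)

/-- Binary length of an integer, including its sign. -/
def bitLength (z : ℤ) : ℕ := z.natAbs.size + 1

/-- Arithmetic expressions over registers and array cells. -/
inductive Expr where
  | const (z : ℤ)
  | reg (x : ℕ)
  | load (a : ℕ) (i : Expr)
  | add (e f : Expr)
  | sub (e f : Expr)
  | mul (e f : Expr)
  | div (e f : Expr)

/-- The value of an expression; division rounds as `Int.ediv` does and `z / 0 = 0`. -/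
def Expr.eval (s : Store) : Expr → ℤ
  | const z => z
  | reg x => s.reg x
  | load a i => s.arr a (i.eval s)
  | add e f => e.eval s + f.eval s
  | sub e f => e.eval s - f.eval s
  | mul e f => e.eval s * f.eval s
  | div e f => e.eval s / f.eval s

/-- The cost of evaluating an expression. -/
def Expr.cost (s : Store) : Expr → ℕ
  | const z => bitLength z + 1
  | reg x => bitLength (s.reg x) + 1
  | load a i => i.cost s + bitLength (i.eval s) + bitLength (s.arr a (i.eval s)) + 1
  | add e f => e.cost s + f.cost s + bitLength (e.eval s) + bitLength (f.eval s) + 1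
  | sub e f => e.cost s + f.cost s + bitLength (e.eval s) + bitLength (f.eval s) + 1
  | mul e f => e.cost s + f.cost s + bitLength (e.eval s) + bitLength (f.eval s) + 1
  | div e f => e.cost s + f.cost s + bitLength (e.eval s) + bitLength (f.eval s) + 1

/-- Programs. Conditionals and loops test whether an expression is positive. -/
inductive Program where
  | skip
  | assign (x : ℕ) (e : Expr)
  | store (a : ℕ) (i e : Expr)
  | seq (P Q : Program)
  | cond (e : Expr) (P Q : Program)
  | loop (e : Expr) (P : Program)

/-- `Exec P s s' c`: the program `P`, started on the store `s`, halts with the store `s'`, at the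
total cost `c`. -/
inductive Exec : Program → Store → Store → ℕ → Prop where
  | skip (s : Store) : Exec .skip s s 1
  | assign (s : Store) (x : ℕ) (e : Expr) :
      Exec (.assign x e) s (s.setReg x (e.eval s)) (e.cost s + bitLength (e.eval s) + 1)
  | store (s : Store) (a : ℕ) (i e : Expr) :
      Exec (.store a i e) s (s.setArr a (i.eval s) (e.eval s))
        (i.cost s + e.cost s + bitLength (i.eval s) + bitLength (e.eval s) + 1)
  | seq {P Q : Program} {s s' s'' : Store} {c c' : ℕ} :
      Exec P s s' c → Exec Q s' s'' c' → Exec (.seq P Q) s s'' (c + c')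
  | cond_pos {e : Expr} {P Q : Program} {s s' : Store} {c : ℕ} :
      0 < e.eval s → Exec P s s' c → Exec (.cond e P Q) s s' (e.cost s + 1 + c)
  | cond_neg {e : Expr} {P Q : Program} {s s' : Store} {c : ℕ} :
      ¬ 0 < e.eval s → Exec Q s s' c → Exec (.cond e P Q) s s' (e.cost s + 1 + c)
  | loop_pos {e : Expr} {P : Program} {s s' s'' : Store} {c c' : ℕ} :
      0 < e.eval s → Exec P s s' c → Exec (.loop e P) s' s'' c' →
        Exec (.loop e P) s s'' (e.cost s + 1 + c + c')
  | loop_neg {e : Expr} {P : Program} {s : Store} :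
      ¬ 0 < e.eval s → Exec (.loop e P) s s (e.cost s + 1)

/-- The function `f` on objects of type `α`, which are encoded as integer sequences by `enc`, is
computable in time polynomial in `size`: one program halts on every encoded object `a` with the
value `f a` in register `0`, at a cost bounded by a fixed polynomial in `size a`. -/
def PolyTimeComputable {α : Type*} (enc : α → List ℤ) (size : α → ℕ) (f : α → ℤ) : Prop :=
  ∃ (P : Program) (q : Polynomial ℕ), ∀ a, ∃ (s : Store) (c : ℕ),
    Exec P (Store.init (enc a)) s c ∧ s.reg 0 = f a ∧ c ≤ q.eval (size a)

end ECP

/-! A walk is determined by its exit lists, which record for each node the successors in the order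
of the visits: each visit uses up the next entry (`IsPath.eq_of_exits_eq`). Conversely, suppose that
lists satisfy the degree conditions of a closed walk at `r`. They come from such a walk exactly when
the last exits lead every node that has exits to `r` (`exists_walk_of_balanced`,
`IsPath.lastExitReaches`). Multiplicities and priorities are conditions on single lists, the
priority edge being first in its list. Hence the lists at different nodes can be chosen
independently once the map `f` of last exits is fixed.

After removal of the leading priority edge, a list is an arbitrary arrangement of a multiset with
multiplicities `c` and total `N`. There are `(N - 1)! * c x / ∏ (c w)!` arrangements that end in
`x`, and `N! / ∏ (c w)!` in all, which is the number needed at `r`. The factors `c (f v)` multiply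
to the weight of `f`, and the maps `f` that lead to `r` are the oriented spanning trees. Their
weighted sum is a determinant (`det_eq_sum_leadsTo`): multilinearity in the rows reduces it to
matrices of single maps, whose determinant is 1 or 0.

The closed formula needs residual edges at every node. The algorithm has to work without them, so it
uses the variant `count_mul_prod_factorial`, in which a node whose only outgoing edge is a priority
edge treats that edge as free, and a node without outgoing edges gets a formal exit to `r`.

The program fills tables one after the other. The determinant comes from traces of matrix powers
through Newton's identities, where all divisions are exact (`newton_charpoly`); the factorials are
affordable because the size counts edges with multiplicity. All values are at most `valueBound`, so
bit lengths are polynomial, and the cost is at most a constant times the square of the iteration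
bound plus one, times the bit length. -/

namespace ECP

/-! ### Determinants of functional graphs -/

section MatrixTree

variable {V : Type*} [Fintype V] [DecidableEq V] {R : Type*} [CommRing R]

/-- Every node is led to `r` by iterating `f`. -/
def LeadsTo (f : V → V) (r : V) : Prop := ∀ v, ∃ k, f^[k] v = r

/-- The matrix with the rows `e_v - e_{f v}` for `v ≠ r` and `e_r`. -/
def functionalLaplacian (R : Type*) [CommRing R] (f : V → V) (r : V) : Matrix V V R :=
  Matrix.of fun v w => (if v = w then 1 else 0) - if v ≠ r ∧ w = f v then 1 else 0

/-- Each node other than `r` is mapped to a node one step closer to `r`. Ordering the nodes by the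
number of steps to `r` therefore makes the matrix block triangular with identity blocks. -/
theorem det_functionalLaplacian_of_leadsTo {f : V → V} {r : V} (h : LeadsTo f r) :
    (functionalLaplacian R f r).det = 1 := by
  classical
  have hd : ∀ v, v ≠ r → Nat.find (h v) = Nat.find (h (f v)) + 1 := by
    intro v hv
    rw [Nat.find_eq_iff]
    refine ⟨?_, ?_⟩
    · rw [Function.iterate_succ_apply]
      exact Nat.find_spec (h (f v))
    · intro k hk
      rcases k with _ | k
      · simpa using hv
      · rw [Function.iterate_succ_apply]
        exact Nat.find_min (h (f v)) (by omega)
  have hb : (functionalLaplacian R f r).BlockTriangular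
      (fun v => OrderDual.toDual (Nat.find (h v))) := by
    intro v w hvw
    have hvw : Nat.find (h v) < Nat.find (h w) := hvw
    have h1 : v ≠ w := by rintro rfl; exact lt_irrefl _ hvw
    have h2 : ¬ (v ≠ r ∧ w = f v) := by
      rintro ⟨hv, rfl⟩
      have := hd v hv
      omega
    simp [functionalLaplacian, h1]
    tauto
  rw [hb.det]
  refine Finset.prod_eq_one fun a _ => ?_
  have h1 : (functionalLaplacian R f r).toSquareBlock
      (fun v => OrderDual.toDual (Nat.find (h v))) a = 1 := by
    ext ⟨v, hv⟩ ⟨w, hw⟩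
    have h2 : ¬ (v ≠ r ∧ w = f v) := by
      rintro ⟨hv', rfl⟩
      have h3 := hd v hv'
      have h4 := hv.trans hw.symm
      simp only [OrderDual.toDual_inj] at h4
      omega
    simp only [functionalLaplacian, Matrix.toSquareBlock_def, Matrix.of_apply, if_neg h2, sub_zero,
      Matrix.one_apply, Subtype.mk.injEq]
  rw [h1, Matrix.det_one]

/-- The indicator of the nodes that never reach `r` is a nonzero kernel vector. The kernel criterion
is applied over `ℤ`, since `R` may have zero divisors, and the result is then transported to `R`. -/
theorem det_functionalLaplacian_of_not_leadsTo {f : V → V} {r : V}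
    (h : ¬ LeadsTo f r) : (functionalLaplacian R f r).det = 0 := by
  classical
  have key : (functionalLaplacian ℤ f r).det = 0 := by
    refine Matrix.exists_mulVec_eq_zero_iff.1
      ⟨fun v => if ∃ k, f^[k] v = r then 0 else 1, ?_, ?_⟩
    · intro h0
      refine h fun v => ?_
      by_contra hv
      simpa [hv] using congrFun h0 v
    · ext v
      simp only [Matrix.mulVec, dotProduct, functionalLaplacian, Matrix.of_apply, sub_mul,
        ite_mul, one_mul, zero_mul, Finset.sum_sub_distrib, Finset.sum_ite_eq, Finset.mem_univ,
        if_true, Pi.zero_apply]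
      by_cases hv : v = r
      · subst hv
        simp [show ∃ k, f^[k] v = v from ⟨0, rfl⟩]
      · have : (∃ k, f^[k] v = r) ↔ ∃ k, f^[k] (f v) = r := by
          constructor
          · rintro ⟨_ | k, hk⟩
            · exact absurd hk hv
            · exact ⟨k, hk⟩
          · rintro ⟨k, hk⟩
            exact ⟨k + 1, hk⟩
        simp [hv, this]
  have := congrArg (Int.castRingHom R) key
  rw [RingHom.map_det, map_zero] at this
  rw [← this]
  congr 1
  ext v w
  simp [functionalLaplacian]

open Classical in
/-- The matrix-tree theorem for functional graphs: a Laplacian determinant enumerates the maps that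
lead every node to `r`. -/
theorem det_eq_sum_leadsTo (U : V → V → R) (r : V) (hU : ∀ w, U r w = if w = r then 1 else 0) :
    (Matrix.of fun v w => (if v = w then ∑ x, U v x else 0) -
      if v ≠ r then U v w else 0 : Matrix V V R).det =
    ∑ f : V → V with LeadsTo f r, ∏ v, U v (f v) := by
  have hrow : (Matrix.of fun v w => (if v = w then ∑ x, U v x else 0) -
      if v ≠ r then U v w else 0 : Matrix V V R) =
      fun v => ∑ x, U v x • fun w => ((if v = w then 1 else 0) -
        if v ≠ r ∧ w = x then 1 else 0 : R) := by
    funext v w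
    by_cases hv : v = r
    · simp [hv, hU, ite_apply]
    · by_cases hw : v = w
      · subst hw
        simp [hv, mul_sub, Finset.sum_sub_distrib]
      · simp [hv, hw]
  -- Expanding every row at once yields a sum over all choices of one summand per row, that is, over
  -- all maps `f`.
  have h := (Matrix.detRowAlternating (n := V) (R := R)).toMultilinearMap.map_sum
    (fun v x => U v x • fun w => ((if v = w then 1 else 0) -
        if v ≠ r ∧ w = x then 1 else 0 : R))
  simp only [MultilinearMap.map_smul_univ] at h
  rw [hrow]
  refine h.trans ?_
  rw [Finset.sum_filter]
  refine Finset.sum_congr rfl fun f _ => ?_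
  have hf : (Matrix.detRowAlternating (n := V) (R := R)).toMultilinearMap
      (fun v w => ((if v = w then 1 else 0) - if v ≠ r ∧ w = f v then 1 else 0 : R)) =
      (functionalLaplacian R f r).det := rfl
  rw [hf, smul_eq_mul]
  split_ifs with hl
  · rw [det_functionalLaplacian_of_leadsTo hl, mul_one]
  · rw [det_functionalLaplacian_of_not_leadsTo hl, mul_zero]

end MatrixTree

/-! ### Oriented trees as maps, and the matrix-tree theorem -/

section Trees

variable {V : Type*}

theorem IsPath.leadsTo {T : Finset (V × V)} {f : V → V} (hT : ∀ e ∈ T, e.2 = f e.1) {v r : V}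
    {p : List (V × V)} (h : IsPath T v p r) : ∃ k, f^[k] v = r := by
  induction p generalizing v with
  | nil => exact ⟨0, h⟩
  | cons e p ih =>
    obtain ⟨he, rfl, hp⟩ := h
    obtain ⟨k, hk⟩ := ih hp
    exact ⟨k + 1, by rw [Function.iterate_succ_apply, ← hT e he, hk]⟩

variable [Fintype V] [DecidableEq V]

/-- The edges from `v` to `f v` for `v ≠ r`. -/
def functionalEdges (f : V → V) (r : V) : Finset (V × V) :=
  (Finset.univ.erase r).image fun v => (v, f v)

theorem mem_functionalEdges {f : V → V} {r : V} {e : V × V} :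
    e ∈ functionalEdges f r ↔ e.1 ≠ r ∧ e.2 = f e.1 := by
  obtain ⟨a, b⟩ := e
  simp only [functionalEdges, Finset.mem_image, Finset.mem_erase, Finset.mem_univ, and_true,
    Prod.mk.injEq]
  constructor
  · rintro ⟨v, hv, rfl, rfl⟩
    exact ⟨hv, rfl⟩
  · rintro ⟨h1, h2⟩
    exact ⟨a, h1, rfl, h2.symm⟩

/-- Existence: follow `f` until `r` is met. Uniqueness: `r` has no outgoing edge and every other
node has just one, so a path never has a choice, not even of when to stop. -/
theorem isOrientedTree_functionalEdges {f : V → V} {r : V} (h : LeadsTo f r) :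
    IsOrientedTree (functionalEdges f r) r := by
  intro v
  obtain ⟨k, hk⟩ := h v
  have hex : ∃ p, IsPath (functionalEdges f r) v p r := by
    clear h
    induction k generalizing v with
    | zero => exact ⟨[], hk⟩
    | succ k ih =>
      by_cases hv : v = r
      · exact ⟨[], hv⟩
      · obtain ⟨p, hp⟩ := ih (f v) hk
        exact ⟨(v, f v) :: p, mem_functionalEdges.2 ⟨hv, rfl⟩, rfl, hp⟩
  obtain ⟨p, hp⟩ := hex
  refine ⟨p, hp, fun q hq => ?_⟩
  clear hk k h
  induction p generalizing v q with
  | nil =>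
    cases q with
    | nil => rfl
    | cons e q =>
      obtain ⟨he, rfl, -⟩ := hq
      exact absurd hp (mem_functionalEdges.1 he).1
  | cons e p ih =>
    obtain ⟨he, rfl, hp⟩ := hp
    cases q with
    | nil => exact absurd hq (mem_functionalEdges.1 he).1
    | cons e' q =>
      obtain ⟨he', h1, hq⟩ := hq
      have : e' = e := Prod.ext h1
        (by rw [(mem_functionalEdges.1 he').2, (mem_functionalEdges.1 he).2, h1])
      subst this
      rw [ih _ hp _ hq]

/-- An edge leaving `r` would extend to a second path from `r` to `r` besides the empty one, and two
edges leaving the same node would extend to two paths to `r`. -/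
theorem IsOrientedTree.exists_functionalEdges {T : Finset (V × V)} {r : V}
    (h : IsOrientedTree T r) : ∃ f, f r = r ∧ LeadsTo f r ∧ functionalEdges f r = T := by
  have hr : ∀ e ∈ T, e.1 ≠ r := by
    rintro e he rfl
    obtain ⟨p, hp, -⟩ := h e.2
    have := (h e.1).unique (y₁ := []) (y₂ := e :: p) rfl ⟨he, rfl, hp⟩
    simp at this
  have hex : ∀ v, ∃ w, (v = r → w = r) ∧ (v ≠ r → (v, w) ∈ T) := by
    intro v
    by_cases hv : v = r
    · exact ⟨r, fun _ => rfl, fun h => absurd hv h⟩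
    · obtain ⟨p, hp, -⟩ := h v
      cases p with
      | nil => exact absurd hp hv
      | cons e p =>
        obtain ⟨he, rfl, -⟩ := hp
        exact ⟨e.2, fun h => absurd h hv, fun _ => he⟩
  choose f hf1 hf2 using hex
  have hT : ∀ e ∈ T, e.2 = f e.1 := by
    intro e he
    obtain ⟨p, hp, -⟩ := h e.2
    obtain ⟨q, hq, -⟩ := h (f e.1)
    have := (h e.1).unique (y₁ := e :: p) (y₂ := (e.1, f e.1) :: q) ⟨he, rfl, hp⟩
      ⟨hf2 _ (hr e he), rfl, hq⟩
    rw [List.cons.injEq] at this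
    exact congrArg Prod.snd this.1
  refine ⟨f, hf1 r rfl, fun v => ?_, ?_⟩
  · obtain ⟨p, hp, -⟩ := h v
    exact hp.leadsTo hT
  · ext e
    rw [mem_functionalEdges]
    constructor
    · rintro ⟨h1, h2⟩
      have := hf2 _ h1
      rwa [← h2] at this
    · exact fun he => ⟨hr e he, hT e he⟩

variable (G : DirectedMultigraph V)

/-- The multiplicities, with a loop at `r` instead of the edges that leave `r`. -/
def DirectedMultigraph.rootedWeight (r v w : V) : ℕ :=
  if v = r then (if w = r then 1 else 0) else G.mult (v, w)

open Classical in
theorem DirectedMultigraph.weightedTreeCount_eq_sum_leadsTo (r : V) :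
    G.weightedTreeCount r =
      ∑ f : V → V with LeadsTo f r, ∏ v, G.rootedWeight r v (f v) := by
  have hpos : ∀ f : V → V, ∏ v, G.rootedWeight r v (f v) ≠ 0 →
      f r = r ∧ functionalEdges f r ⊆ G.edges := by
    intro f hf
    rw [Finset.prod_ne_zero_iff] at hf
    constructor
    · have := hf r (Finset.mem_univ _)
      simpa [rootedWeight] using this
    · intro e he
      rw [mem_functionalEdges] at he
      have := hf e.1 (Finset.mem_univ _)
      rw [rootedWeight, if_neg he.1, ← he.2] at this
      simpa [edges] using Nat.pos_of_ne_zero this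
  have hprod : ∀ f : V → V, f r = r →
      ∏ v, G.rootedWeight r v (f v) = ∏ e ∈ functionalEdges f r, G.mult e := by
    intro f hf
    rw [functionalEdges, Finset.prod_image (fun a _ b _ hab => (Prod.mk.inj hab).1),
      ← Finset.mul_prod_erase _ _ (Finset.mem_univ r)]
    rw [rootedWeight, if_pos rfl, if_pos hf, one_mul]
    refine Finset.prod_congr rfl fun v hv => ?_
    rw [rootedWeight, if_neg (Finset.ne_of_mem_erase hv)]
  rw [weightedTreeCount, ← Finset.sum_filter_ne_zero (s := Finset.filter _ _)]
  symm
  refine Finset.sum_bij_ne_zero (fun f _ _ => functionalEdges f r) ?_ ?_ ?_ ?_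
  · intro f hf hne
    simp only [Finset.mem_filter, Finset.mem_univ, true_and] at hf
    simp only [orientedSpanningTrees, Finset.mem_filter, Finset.mem_powerset]
    exact ⟨(hpos f hne).2, isOrientedTree_functionalEdges hf.1⟩
  · intro f hf hf0 g hg hg0 hfg
    funext v
    by_cases hv : v = r
    · rw [hv, (hpos f hf0).1, (hpos g hg0).1]
    · have : (v, f v) ∈ functionalEdges f r := mem_functionalEdges.2 ⟨hv, rfl⟩
      rw [hfg] at this
      exact (mem_functionalEdges.1 this).2
  · intro T hT hT0
    simp only [orientedSpanningTrees, Finset.mem_filter, Finset.mem_powerset] at hT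
    obtain ⟨f, hf1, hf2, rfl⟩ := hT.2.exists_functionalEdges
    have h0 : ∏ v, G.rootedWeight r v (f v) ≠ 0 := by rwa [hprod f hf1]
    exact ⟨f, by simp [hf2, h0], h0, rfl⟩
  · intro f hf hf0
    exact hprod f (hpos f hf0).1

/-- Stated for a general additive monoid so that `Additive` yields the corresponding identity for
products. -/
theorem DirectedMultigraph.sum_outEdges {M : Type*} [AddCommMonoid M] (v : V) (g : V × V → M)
    (hg : ∀ e, G.mult e = 0 → g e = 0) : ∑ e ∈ G.outEdges v, g e = ∑ w, g (v, w) := by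
  symm
  refine Finset.sum_bij_ne_zero (fun w _ _ => (v, w)) ?_ ?_ ?_ ?_
  · intro w _ h
    simp only [outEdges, edges, Finset.mem_filter, Finset.mem_univ, true_and, and_true]
    exact Nat.pos_of_ne_zero fun h0 => h (hg _ h0)
  · intro a _ _ b _ _ h
    exact (Prod.mk.inj h).2
  · rintro ⟨a, b⟩ he h
    simp only [outEdges, Finset.mem_filter] at he
    obtain ⟨-, rfl⟩ := he
    exact ⟨b, Finset.mem_univ _, h, rfl⟩
  · intros
    rfl

theorem DirectedMultigraph.outDegree_eq_sum (v : V) : G.outDegree v = ∑ w, G.mult (v, w) :=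
  G.sum_outEdges v _ fun _ h => h

theorem DirectedMultigraph.inDegree_eq_sum (v : V) : G.inDegree v = ∑ u, G.mult (u, v) := by
  symm
  refine Finset.sum_bij_ne_zero (fun u _ _ => (u, v)) ?_ ?_ ?_ ?_
  · intro w _ h
    simp only [inEdges, edges, Finset.mem_filter, Finset.mem_univ, true_and, and_true]
    exact Nat.pos_of_ne_zero h
  · intro a _ _ b _ _ h
    exact (Prod.mk.inj h).1
  · rintro ⟨a, b⟩ he h
    simp only [inEdges, Finset.mem_filter] at he
    obtain ⟨-, rfl⟩ := he
    exact ⟨a, Finset.mem_univ _, h, rfl⟩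
  · intros
    rfl

/-- The directed matrix-tree theorem. -/
theorem DirectedMultigraph.weightedTreeCount_eq_det (r : V) :
    (G.weightedTreeCount r : ℤ) = (G.reducedLaplacian r).det := by
  classical
  have h := det_eq_sum_leadsTo (fun v w => (G.rootedWeight r v w : ℤ)) r
    (fun w => by simp [rootedWeight])
  rw [G.weightedTreeCount_eq_sum_leadsTo r]
  push_cast
  -- The row of `r` is a unit vector, so the determinant splits off a factor 1 and the minor without
  -- `r` remains.
  rw [← h, Matrix.twoBlockTriangular_det _ (fun v => v ≠ r)]
  · have h1 : ∀ (M : Matrix {v // ¬ v ≠ r} {v // ¬ v ≠ r} ℤ),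
        (∀ v, M v v = 1) → M.det = 1 := by
      intro M hM
      have : M = 1 := by
        ext ⟨v, hv⟩ ⟨w, hw⟩
        obtain rfl := not_not.1 hv
        obtain rfl := not_not.1 hw
        rw [hM, Matrix.one_apply_eq]
      rw [this, Matrix.det_one]
    rw [h1, mul_one]
    · congr 1
      ext ⟨v, hv⟩ ⟨w, hw⟩
      by_cases hvw : v = w
      · subst hvw
        simp [Matrix.toSquareBlockProp, reducedLaplacian, laplacian, rootedWeight, hv,
          G.outDegree_eq_sum, G.loopless]
      · simp [Matrix.toSquareBlockProp, reducedLaplacian, laplacian, rootedWeight, hv, hvw]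
    · rintro ⟨v, hv⟩
      obtain rfl := not_not.1 hv
      simp [Matrix.toSquareBlockProp, rootedWeight]
  · intro v hv w hw
    obtain rfl := not_not.1 hv
    simp [Ne.symm hw]

end Trees

/-! ### Newton's identities for the characteristic polynomial -/

section Newton

open Polynomial Matrix

variable {V : Type*} [Fintype V] [DecidableEq V] {R : Type*} [CommRing R]

theorem derivative_det_eq_sum (M : Matrix V V R[X]) :
    derivative M.det = ∑ i, (M.updateCol i fun j => derivative (M j i)).det := by
  simp only [Matrix.det_apply, map_sum]
  rw [Finset.sum_comm]
  refine Finset.sum_congr rfl fun σ _ => ?_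
  rw [← Finset.smul_sum, Units.smul_def, Units.smul_def, derivative_smul,
    Polynomial.derivative_prod_finset]
  congr 1
  refine Finset.sum_congr rfl fun i _ => ?_
  rw [← Finset.prod_erase_mul _ _ (Finset.mem_univ i), Matrix.updateCol_self]
  congr 1
  refine Finset.prod_congr rfl fun j hj => ?_
  rw [Matrix.updateCol_ne (Finset.ne_of_mem_erase hj)]

/-- Jacobi's formula: differentiating column `i` of `X - M` leaves the unit vector `e_i`, and the
resulting determinant is the `i`-th diagonal entry of the adjugate. -/
theorem derivative_charpoly_eq_trace (M : Matrix V V R) :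
    derivative M.charpoly = (M.charmatrix.adjugate).trace := by
  rw [Matrix.charpoly, derivative_det_eq_sum, Matrix.trace]
  refine Finset.sum_congr rfl fun i _ => ?_
  have h : M.charmatrix.adjugate i i = M.charmatrixᵀ.adjugate i i := by
    rw [← Matrix.adjugate_transpose, Matrix.transpose_apply]
  rw [Matrix.diag_apply, h, Matrix.adjugate_apply, Matrix.updateRow_transpose,
    Matrix.det_transpose]
  congr 2
  funext j
  by_cases h : j = i
  · subst h
    simp [Matrix.charmatrix_apply_eq]
  · simp [h]

/-- The coefficients of the adjugate of the characteristic matrix. -/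
theorem coeff_adjugate_charmatrix (M : Matrix V V R) (j L : ℕ) :
    (matPolyEquiv M.charmatrix.adjugate).coeff j =
      (matPolyEquiv M.charmatrix.adjugate).coeff (j + L) * M ^ L +
        ∑ i ∈ Finset.range L, M.charpoly.coeff (j + 1 + i) • M ^ i := by
  -- Compare the coefficients of `X ^ (j + 1)` in `adj(X - M) * (X - M) = charpoly`. The lemma
  -- iterates this `L` times.
  have h0 : ∀ j, (matPolyEquiv M.charmatrix.adjugate).coeff j =
      (matPolyEquiv M.charmatrix.adjugate).coeff (j + 1) * M +
        M.charpoly.coeff (j + 1) • (1 : Matrix V V R) := by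
    intro j
    have h := congrArg (fun p => (matPolyEquiv p).coeff (j + 1))
      (Matrix.adjugate_mul M.charmatrix)
    simp only [map_mul, matPolyEquiv_charmatrix] at h
    rw [Polynomial.coeff_mul_X_sub_C, ← Matrix.charpoly, matPolyEquiv_smul_one,
      Polynomial.coeff_map, Algebra.algebraMap_eq_smul_one] at h
    rw [← h]
    abel
  induction L with
  | zero => simp
  | succ L ih =>
    rw [ih, h0 (j + L), Finset.sum_range_succ, add_mul, pow_succ', smul_mul_assoc, one_mul,
      mul_assoc, add_assoc, add_assoc]
    congr 1
    rw [add_comm, show j + (L + 1) = j + 1 + L by ring]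

/-- Newton's identities for the coefficients of the characteristic polynomial. -/
theorem newton_charpoly (M : Matrix V V R) (k : ℕ) (hk : k + 1 ≤ Fintype.card V) :
    ((k + 1 : ℕ) : R) * M.charpoly.coeff (Fintype.card V - (k + 1)) =
      -∑ i ∈ Finset.range (k + 1),
        M.charpoly.coeff (Fintype.card V - (k - i)) * (M ^ (i + 1)).trace := by
  nontriviality R
  set N := Fintype.card V with hN
  have hz : ∀ m, N < m → M.charpoly.coeff m = 0 := fun m hm =>
    Polynomial.coeff_eq_zero_of_natDegree_lt (by rwa [Matrix.charpoly_natDegree_eq_dim])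
  have hsum : ∑ i ∈ Finset.range (k + 2),
      M.charpoly.coeff (N - (k + 1) + i) * (M ^ i).trace =
      ((N - (k + 1) : ℕ) : R) * M.charpoly.coeff (N - (k + 1)) := by
    -- For `k + 1 = N` this is the trace of the Cayley–Hamilton identity. Otherwise the trace of a
    -- coefficient of the adjugate is computed in two ways, by Jacobi's formula and by the
    -- recursion.
    rcases Nat.eq_or_lt_of_le hk with hk | hk
    · have h := congrArg Matrix.trace (Matrix.aeval_self_charpoly M)
      rw [Polynomial.aeval_eq_sum_range, Matrix.trace_sum, Matrix.charpoly_natDegree_eq_dim,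
        ← hN, ← hk] at h
      simp only [Matrix.trace_smul, smul_eq_mul, Matrix.trace_zero] at h
      rw [← hk]
      simpa using h
    · obtain ⟨j, hj⟩ : ∃ j, N = j + 1 + (k + 1) := ⟨N - (k + 2), by omega⟩
      have hj' : N - (k + 1) = j + 1 := by omega
      set Q := matPolyEquiv M.charmatrix.adjugate with hQ
      -- So many iterations push the adjugate term beyond its degree; the summands with `i ≥ k + 2`
      -- vanish as well, because they involve coefficients above degree `N`.
      have h1 := coeff_adjugate_charmatrix M j (k + 2 + (Q.natDegree + 1))
      rw [← hQ, Polynomial.coeff_eq_zero_of_natDegree_lt (n := j + (k + 2 + (Q.natDegree + 1)))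
        (by omega), zero_mul, zero_add, Finset.sum_range_add] at h1
      rw [Finset.sum_eq_zero (s := Finset.range (Q.natDegree + 1)), add_zero] at h1
      · have h2 := congrArg Matrix.trace h1
        rw [Matrix.trace_sum] at h2
        simp only [Matrix.trace_smul, smul_eq_mul] at h2
        rw [hj', ← h2]
        have h3 : (Q.coeff j).trace = (derivative M.charpoly).coeff j := by
          rw [derivative_charpoly_eq_trace, Matrix.trace, Matrix.trace,
            Polynomial.finsetSum_coeff]
          refine Finset.sum_congr rfl fun i _ => ?_
          rw [hQ, Matrix.diag_apply, matPolyEquiv_coeff_apply, Matrix.diag_apply]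
        rw [h3, Polynomial.coeff_derivative]
        push_cast
        ring
      · intro i _
        rw [hz _ (by omega), zero_smul]
  rw [Finset.sum_range_succ'] at hsum
  simp only [pow_zero, Matrix.trace_one, add_zero, ← hN] at hsum
  have h4 : ∑ i ∈ Finset.range (k + 1),
      M.charpoly.coeff (N - (k - i)) * (M ^ (i + 1)).trace = ∑ i ∈ Finset.range (k + 1),
      M.charpoly.coeff (N - (k + 1) + (i + 1)) * (M ^ (i + 1)).trace := by
    refine Finset.sum_congr rfl fun i hi => ?_
    rw [Finset.mem_range] at hi
    rw [show N - (k - i) = N - (k + 1) + (i + 1) by omega]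
  rw [h4, eq_neg_iff_add_eq_zero]
  have h5 : (N : R) = ((N - (k + 1) : ℕ) : R) + ((k + 1 : ℕ) : R) := by
    rw [← Nat.cast_add, Nat.sub_add_cancel hk]
  rw [h5] at hsum
  linear_combination hsum

end Newton

/-! ### Counting arrangements of a multiset -/

section Arrangements

variable {V : Type*} [Fintype V] [DecidableEq V]

/-- The lists that contain each `w` exactly `c w` times. -/
def arrangements (c : V → ℕ) : Finset (List V) :=
  (∑ w, Multiset.replicate (c w) w).lists.toFinset

theorem mem_arrangements {c : V → ℕ} {l : List V} :
    l ∈ arrangements c ↔ ∀ w, l.count w = c w := by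
  have h : ∀ w, (∑ x, Multiset.replicate (c x) x).count w = c w := by
    intro w
    rw [Multiset.count_sum']
    simp [Multiset.count_replicate]
  rw [arrangements, Multiset.mem_toFinset, Multiset.mem_lists_iff]
  refine Multiset.ext.trans (forall_congr' fun w => ?_)
  rw [h, Multiset.quot_mk_to_coe, Multiset.coe_count, eq_comm]

theorem length_eq_sum_count (l : List V) : l.length = ∑ w, l.count w := by
  have h := Multiset.sum_count_eq_card (s := Finset.univ) (m := (l : Multiset V))
    (fun a _ => Finset.mem_univ a)
  simpa using h.symm

theorem length_of_mem_arrangements {c : V → ℕ} {l : List V} (h : l ∈ arrangements c) :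
    l.length = ∑ w, c w := by
  rw [length_eq_sum_count]
  exact Finset.sum_congr rfl fun w _ => mem_arrangements.1 h w

theorem card_arrangements_getLast_aux {c : V → ℕ} {x : V} (hx : c x ≠ 0) :
    ((arrangements c).filter fun l => l.getLast? = some x).card =
      (arrangements (Function.update c x (c x - 1))).card := by
  symm
  refine Finset.card_bij (fun l _ => l ++ [x]) ?_ ?_ ?_
  · intro l hl
    rw [mem_arrangements] at hl
    rw [Finset.mem_filter, mem_arrangements]
    refine ⟨fun w => ?_, by simp⟩
    rw [List.count_append, hl]
    by_cases hw : w = x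
    · subst hw
      simp
      omega
    · simp [hw, Ne.symm hw]
  · intro a _ b _ h
    exact List.append_cancel_right h
  · intro l hl
    rw [Finset.mem_filter, mem_arrangements] at hl
    obtain ⟨hl, hx⟩ := hl
    obtain ⟨l', rfl⟩ := List.getLast?_eq_some_iff.1 hx
    refine ⟨l', ?_, rfl⟩
    rw [mem_arrangements]
    intro w
    have := hl w
    rw [List.count_append] at this
    by_cases hw : w = x
    · subst hw
      simp at this ⊢
      omega
    · simp [hw, Ne.symm hw] at this ⊢
      omega

theorem prod_factorial_update {c : V → ℕ} {x : V} (hx : c x ≠ 0) :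
    ∏ w, (c w).factorial = c x * ∏ w, (Function.update c x (c x - 1) w).factorial := by
  rw [← Finset.mul_prod_erase _ _ (Finset.mem_univ x),
    ← Finset.mul_prod_erase _ (fun w => (Function.update c x (c x - 1) w).factorial)
      (Finset.mem_univ x), Function.update_self, ← mul_assoc,
    Nat.mul_factorial_pred hx]
  congr 1
  refine Finset.prod_congr rfl fun w hw => ?_
  rw [Function.update_of_ne (Finset.ne_of_mem_erase hw)]

theorem sum_update_pred {c : V → ℕ} {x : V} (hx : c x ≠ 0) :
    ∑ w, Function.update c x (c x - 1) w = ∑ w, c w - 1 := by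
  have h : ∑ w ∈ Finset.univ.erase x, Function.update c x (c x - 1) w =
      ∑ w ∈ Finset.univ.erase x, c w :=
    Finset.sum_congr rfl fun w hw => Function.update_of_ne (Finset.ne_of_mem_erase hw) _ _
  rw [← Finset.add_sum_erase _ c (Finset.mem_univ x),
    ← Finset.add_sum_erase _ (Function.update c x (c x - 1)) (Finset.mem_univ x),
    Function.update_self, h]
  omega

/-- Classify by the last entry `x`: removing it lowers `c x` by one, so by induction `x` contributes
`c x * N!`, and these contributions add up to `(N + 1)!`. -/
theorem card_arrangements_mul (c : V → ℕ) :
    (arrangements c).card * ∏ w, (c w).factorial = (∑ w, c w).factorial := by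
  induction hN : ∑ w, c w generalizing c with
  | zero =>
    have hc : ∀ w, c w = 0 := fun w => by
      have := Finset.sum_eq_zero_iff.1 hN w (Finset.mem_univ w)
      exact this
    have : arrangements c = {[]} := by
      ext l
      rw [mem_arrangements, Finset.mem_singleton]
      constructor
      · intro h
        rw [← List.length_eq_zero_iff, length_eq_sum_count]
        simp [h, hc]
      · rintro rfl w
        simp [hc]
    simp [this, hc]
  | succ N ih =>
    have h1 : (arrangements c).card =
        ∑ x, ((arrangements c).filter fun l => l.getLast? = some x).card := by
      have := Finset.card_eq_sum_card_fiberwise (f := fun l : List V => l.getLast?)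
        (s := arrangements c) (t := Finset.univ.image some) (by
          intro l hl
          have hl' := length_of_mem_arrangements hl
          have hne : l ≠ [] := by
            rintro rfl
            simp [hN] at hl'
          simp only [Finset.coe_image, Finset.coe_univ, Set.image_univ, Set.mem_range]
          exact ⟨l.getLast hne, (List.getLast?_eq_some_getLast hne).symm⟩)
      rw [this, Finset.sum_image (fun a _ b _ h => Option.some.inj h)]
    rw [h1, Finset.sum_mul, Nat.factorial_succ, ← hN, Finset.sum_mul]
    refine Finset.sum_congr rfl fun x _ => ?_
    by_cases hx : c x = 0
    · rw [hx, zero_mul, Finset.card_eq_zero.2, zero_mul]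
      rw [Finset.filter_eq_empty_iff]
      intro l hl h
      have h3 := List.mem_of_getLast? h
      rw [← List.count_pos_iff, mem_arrangements.1 hl, hx] at h3
      exact lt_irrefl _ h3
    · rw [card_arrangements_getLast_aux hx, prod_factorial_update hx, mul_left_comm,
        ih _ (by rw [sum_update_pred hx, hN, Nat.add_sub_cancel])]

theorem card_arrangements_getLast_mul (c : V → ℕ) (x : V) :
    ((arrangements c).filter fun l => l.getLast? = some x).card * ∏ w, (c w).factorial =
      (∑ w, c w - 1).factorial * c x := by
  by_cases hx : c x = 0
  · rw [hx, mul_zero, Finset.card_eq_zero.2, zero_mul]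
    rw [Finset.filter_eq_empty_iff]
    intro l hl h
    have h3 := List.mem_of_getLast? h
    rw [← List.count_pos_iff, mem_arrangements.1 hl, hx] at h3
    exact lt_irrefl _ h3
  · rw [card_arrangements_getLast_aux hx, prod_factorial_update hx, mul_left_comm,
      card_arrangements_mul, sum_update_pred hx, mul_comm]

end Arrangements

/-! ### Walks and their exit lists -/

section Exits

variable {V : Type*} [DecidableEq V]

/-- The successors of `v` along `p`, in the order of the visits. -/
def exits (p : List (V × V)) (v : V) : List V := (p.filter fun e => e.1 = v).map Prod.snd

@[simp] theorem exits_nil (v : V) : exits [] v = [] := rfl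

theorem exits_cons (e : V × V) (p : List (V × V)) (v : V) :
    exits (e :: p) v = if e.1 = v then e.2 :: exits p v else exits p v := by
  by_cases h : e.1 = v <;> simp [exits, h]

theorem exits_append (p q : List (V × V)) (v : V) :
    exits (p ++ q) v = exits p v ++ exits q v := by
  simp [exits]

theorem count_exits (p : List (V × V)) (v w : V) : (exits p v).count w = p.count (v, w) := by
  induction p with
  | nil => rfl
  | cons e p ih =>
    obtain ⟨a, b⟩ := e
    rw [exits_cons, List.count_cons]
    by_cases h : a = v
    · simp [h, ih, List.count_cons]
    · simp [h, ih]

theorem mem_exits {p : List (V × V)} {v w : V} : w ∈ exits p v ↔ (v, w) ∈ p := by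
  rw [← List.count_pos_iff, count_exits, List.count_pos_iff]

theorem IsPath.eq_of_exits_eq {E E' : Finset (V × V)} {u w w' : V} {p q : List (V × V)}
    (hp : IsPath E u p w) (hq : IsPath E' u q w') (h : exits p = exits q) : p = q := by
  induction p generalizing u q with
  | nil =>
    cases q with
    | nil => rfl
    | cons e q =>
      have := congrFun h e.1
      simp [exits_cons] at this
  | cons e p ih =>
    cases q with
    | nil =>
      have := congrFun h e.1
      simp [exits_cons] at this
    | cons e' q =>
      obtain ⟨-, h1, hp⟩ := hp
      obtain ⟨-, h2, hq⟩ := hq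
      have h3 := congrFun h u
      simp only [exits_cons, h1, h2, if_true, List.cons.injEq] at h3
      obtain rfl : e = e' := Prod.ext (h1.trans h2.symm) h3.1
      rw [ih hp hq]
      funext v
      have h4 := congrFun h v
      simp only [exits_cons] at h4
      split_ifs at h4
      · exact (List.cons.inj h4).2
      · exact h4

/-- Multiplicity one matters for the converse: if another edge with the same tail preceded `f`, the
first exit would be an occurrence of `f` before the given one. -/
theorem respects_at_iff {p : List (V × V)} {f : V × V} (h : p.count f = 1) :
    (∀ p₁ p₂, p = p₁ ++ f :: p₂ → ∀ e ∈ p₁, e.1 ≠ f.1) ↔ (exits p f.1).head? = some f.2 := by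
  constructor
  · intro h1
    obtain ⟨s, t, rfl⟩ := List.append_of_mem (List.count_pos_iff.1 (by omega : 0 < p.count f))
    have hs : exits s f.1 = [] := by
      rw [List.eq_nil_iff_forall_not_mem]
      intro w hw
      exact h1 s t rfl _ (mem_exits.1 hw) rfl
    simp [exits_append, hs, exits_cons]
  · rintro h1 s t rfl e he hef
    rw [exits_append] at h1
    have hne : exits s f.1 ≠ [] := by
      intro h0
      have : e.2 ∈ exits s f.1 := mem_exits.2 (by rw [← hef]; exact he)
      rw [h0] at this
      exact List.not_mem_nil this
    rw [List.head?_append_of_ne_nil _ hne] at h1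
    have h2 := mem_exits.1 (List.mem_of_head? h1)
    rw [List.count_append, List.count_cons_self] at h
    have := List.count_pos_iff.2 h2
    have h4 : List.count f s = List.count (f.1, f.2) s := rfl
    omega

/-- The chain of last exits from the given node ends in `r`. -/
inductive LastExitReaches (l : V → List V) (r : V) : V → Prop
  | root : LastExitReaches l r r
  | step {v w : V} : (l v).getLast? = some w → LastExitReaches l r w → LastExitReaches l r v

variable [Fintype V]

/-- The degree conditions for a walk from `u` to `r` with the exits `l`. -/
def DegreeBalanced (l : V → List V) (u r : V) : Prop :=
  ∀ v, (l v).length + (if v = r then 1 else 0) =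
    ∑ x, (l x).count v + if v = u then 1 else 0

/-- Walk greedily, always using the first remaining exit. Last exits are consumed last, so the
chains that lead to `r` survive wherever exits remain; hence the walk cannot get stuck before all
lists are empty. -/
theorem exists_walk_of_balanced (l : V → List V) (u r : V) (hb : DegreeBalanced l u r)
    (hl : ∀ v, l v ≠ [] → LastExitReaches l r v) :
    ∃ p, IsPath Finset.univ u p r ∧ exits p = l := by
  induction hN : ∑ v, (l v).length generalizing l u with
  | zero =>
    have h0 : ∀ v, l v = [] := fun v => by
      have := Finset.sum_eq_zero_iff.1 hN v (Finset.mem_univ v)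
      exact List.length_eq_zero_iff.1 this
    refine ⟨[], ?_, ?_⟩
    · have := hb u
      simp only [h0, List.length_nil, List.count_nil, Finset.sum_const_zero, if_true] at this
      by_contra h
      rw [if_neg (show ¬ u = r from h)] at this
      omega
    · funext v
      rw [h0, exits_nil]
  | succ N ih =>
    have hin : ∀ x v, v ∈ l x → 0 < ∑ x, (l x).count v := fun x v h =>
      lt_of_lt_of_le (List.count_pos_iff.2 h)
        (Finset.single_le_sum (f := fun x => (l x).count v) (fun _ _ => Nat.zero_le _)
          (Finset.mem_univ x))
    cases hu : l u with
    | nil =>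
      have h1 := hb u
      rw [hu] at h1
      simp only [List.length_nil, if_true] at h1
      have hur : u = r := by
        by_contra h
        rw [if_neg h] at h1
        omega
      subst hur
      rw [if_pos rfl] at h1
      -- The walk stands at `r` with no exit left, so by balance no remaining edge enters `r`. But a
      -- chain from a node with remaining exits would have to enter `r`.
      have hlr : ∀ v, LastExitReaches l u v → v = u ∨ ∃ x, u ∈ l x := by
        intro v hv
        induction hv with
        | root => exact Or.inl rfl
        | @step a b h _ ih =>
          rcases ih with rfl | ih
          · exact Or.inr ⟨a, List.mem_of_getLast? h⟩
          · exact Or.inr ih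
      exfalso
      obtain ⟨v, -, hv⟩ : ∃ v ∈ Finset.univ, (l v).length ≠ 0 := by
        by_contra! h
        rw [Finset.sum_eq_zero h] at hN
        omega
      have hv : l v ≠ [] := fun h => hv (by rw [h]; rfl)
      rcases hlr v (hl v hv) with rfl | ⟨x, hx⟩
      · exact hv hu
      · have := hin x u hx
        omega
    | cons w t =>
      set l' := Function.update l u t with hl'
      have hlen : ∀ v, (l v).length = (l' v).length + if v = u then 1 else 0 := by
        intro v
        by_cases h : v = u
        · subst h
          simp [hl', hu]
        · simp [hl', h]
      have hcount : ∀ v, ∑ x, (l x).count v = ∑ x, (l' x).count v + if v = w then 1 else 0 := by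
        intro v
        rw [← Finset.add_sum_erase _ _ (Finset.mem_univ u),
          ← Finset.add_sum_erase _ (fun x => (l' x).count v) (Finset.mem_univ u)]
        have h : ∑ x ∈ Finset.univ.erase u, (l' x).count v =
            ∑ x ∈ Finset.univ.erase u, (l x).count v :=
          Finset.sum_congr rfl fun x hx => by
            rw [hl', Function.update_of_ne (Finset.ne_of_mem_erase hx)]
        rw [h, hu, hl', Function.update_self, List.count_cons]
        simp only [beq_iff_eq, eq_comm (a := w)]
        omega
      have hb' : DegreeBalanced l' w r := by
        intro v
        have h1 := hb v
        have h2 := hlen v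
        have h3 := hcount v
        omega
      have hlast : ∀ v x, l' v ≠ [] → (l v).getLast? = some x → (l' v).getLast? = some x := by
        intro v x h1 h2
        by_cases h : v = u
        · subst h
          rw [hl', Function.update_self] at h1 ⊢
          rw [hu] at h2
          obtain ⟨y, t', rfl⟩ := List.exists_cons_of_ne_nil h1
          simpa [List.getLast?_cons_cons] using h2
        · rwa [hl', Function.update_of_ne h]
      have hl2 : ∀ v, LastExitReaches l r v → (v = r ∨ l' v ≠ []) → LastExitReaches l' r v := by
        intro v hv
        induction hv with
        | root => exact fun _ => .root
        | @step a b h _ ih =>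
          rintro (rfl | ha)
          · exact .root
          · have h1 := hlast _ _ ha h
            refine .step h1 (ih ?_)
            -- A node `b ≠ r` that is still entered from `a` must have an exit left, by balance.
            by_contra! h2
            have h3 := hb' b
            rw [h2.2, if_neg h2.1] at h3
            have h4 : 0 < ∑ x, (l' x).count b :=
              lt_of_lt_of_le (List.count_pos_iff.2 (List.mem_of_getLast? h1))
                (Finset.single_le_sum (f := fun x => (l' x).count b) (fun _ _ => Nat.zero_le _)
                  (Finset.mem_univ a))
            simp only [List.length_nil] at h3
            omega
      have hl3 : ∀ v, l' v ≠ [] → LastExitReaches l' r v := by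
        intro v hv
        refine hl2 v (hl v ?_) (Or.inr hv)
        intro h
        have := hlen v
        rw [h, List.length_nil] at this
        exact hv (List.length_eq_zero_iff.1 (by omega))
      have hN' : ∑ v, (l' v).length = N := by
        simp only [hlen, Finset.sum_add_distrib, Finset.sum_ite_eq', Finset.mem_univ,
          if_true] at hN
        omega
      obtain ⟨p, hp1, hp2⟩ := ih l' w hb' hl3 hN'
      refine ⟨(u, w) :: p, ⟨Finset.mem_univ _, rfl, hp1⟩, ?_⟩
      funext v
      rw [exits_cons, hp2]
      by_cases h : u = v
      · subst h
        simp [hl', hu]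
      · simp [h, hl', Function.update_of_ne (Ne.symm h)]

theorem IsPath.degreeBalanced {E : Finset (V × V)} {u r : V} {p : List (V × V)}
    (h : IsPath E u p r) : DegreeBalanced (exits p) u r := by
  induction p generalizing u with
  | nil =>
    obtain rfl : u = r := h
    intro v
    simp
  | cons e p ih =>
    obtain ⟨-, rfl, hp⟩ := h
    intro v
    have h1 := ih hp v
    have hlen : (exits (e :: p) v).length = (exits p v).length + if v = e.1 then 1 else 0 := by
      rw [exits_cons]
      by_cases h : e.1 = v
      · simp [h]
      · simp [h, Ne.symm h]
    have hcount : ∑ x, (exits (e :: p) x).count v =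
        ∑ x, (exits p x).count v + if v = e.2 then 1 else 0 := by
      have : ∀ x, (exits (e :: p) x).count v =
          (exits p x).count v + if e.1 = x then (if v = e.2 then 1 else 0) else 0 := by
        intro x
        rw [exits_cons]
        split_ifs with h1 h2
        · simp [h2]
        · simp [Ne.symm h2]
        · simp
      rw [Finset.sum_congr rfl fun x _ => this x, Finset.sum_add_distrib]
      simp
    omega

/-- Prepending an edge keeps all existing last exits. It creates a new one only if its tail has no
later exit, and then its head either has a later exit or is the end `r` of the walk. -/
theorem IsPath.lastExitReaches {E : Finset (V × V)} {u r : V} {p : List (V × V)}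
    (h : IsPath E u p r) (v : V) (hv : exits p v ≠ []) : LastExitReaches (exits p) r v := by
  induction p generalizing u v with
  | nil => exact absurd rfl hv
  | cons e p ih =>
    obtain ⟨-, rfl, hp⟩ := h
    have hmono : ∀ x, LastExitReaches (exits p) r x → LastExitReaches (exits (e :: p)) r x := by
      intro x hx
      induction hx with
      | root => exact .root
      | @step a b h _ ih =>
        refine .step ?_ ih
        rw [exits_cons]
        split_ifs
        · rw [List.getLast?_cons, h]
          rfl
        · exact h
    by_cases h0 : exits p v = []
    · have h1 : e.1 = v := by
        by_contra h
        rw [exits_cons, if_neg h] at hv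
        exact hv h0
      subst h1
      refine .step (w := e.2) (by simp [exits_cons, h0]) ?_
      by_cases h2 : exits p e.2 = []
      · have h3 := hp.degreeBalanced e.2
        rw [h2] at h3
        simp only [List.length_nil, if_true] at h3
        have : e.2 = r := by
          by_contra h
          rw [if_neg h] at h3
          omega
        rw [this]
        exact .root
      · exact hmono _ (ih hp _ h2)
    · exact hmono _ (ih hp _ h0)

/-- The successor of `v` in the graph of last exits, which is `r` if there is no exit. -/
def lastExit (l : V → List V) (r v : V) : V := if v = r then r else (l v).getLast?.getD r

/-- Nodes without exits are sent to `r` by convention, so they do no harm. Conversely, such a node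
is not entered by any exit in a balanced family, so the iteration never uses that convention when it
starts at a node with exits. -/
theorem lastExitReaches_iff_leadsTo {l : V → List V} {r : V} (hb : DegreeBalanced l r r) :
    (∀ v, l v ≠ [] → LastExitReaches l r v) ↔ LeadsTo (lastExit l r) r := by
  constructor
  · intro h v
    by_cases hv : l v = []
    · exact ⟨1, by simp [lastExit, hv]⟩
    · have := h v hv
      clear hv
      induction this with
      | root => exact ⟨0, rfl⟩
      | @step a b hab _ ih =>
        obtain ⟨k, hk⟩ := ih
        by_cases ha : a = r
        · exact ⟨0, ha⟩
        · exact ⟨k + 1, by rw [Function.iterate_succ_apply, lastExit, if_neg ha, hab]; exact hk⟩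
  · intro h v hv
    obtain ⟨k, hk⟩ := h v
    induction k generalizing v with
    | zero =>
      obtain rfl : v = r := hk
      exact .root
    | succ k ih =>
      by_cases hvr : v = r
      · subst hvr
        exact .root
      have hlast : (l v).getLast? = some ((l v).getLast hv) := List.getLast?_eq_some_getLast hv
      have hf : lastExit l r v = (l v).getLast hv := by rw [lastExit, if_neg hvr, hlast]; rfl
      rw [Function.iterate_succ_apply, hf] at hk
      refine .step hlast (ih _ ?_ hk)
      intro h0
      have h1 := hb ((l v).getLast hv)
      rw [h0] at h1
      have h4 : 0 < ∑ x, (l x).count ((l v).getLast hv) :=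
        lt_of_lt_of_le (List.count_pos_iff.2 (List.getLast_mem hv))
          (Finset.single_le_sum (f := fun x => (l x).count ((l v).getLast hv))
            (fun _ _ => Nat.zero_le _) (Finset.mem_univ v))
      simp only [List.length_nil] at h1
      omega

end Exits

/-! ### The modified BEST theorem -/

namespace Instance

variable {V : Type*} [Fintype V] [DecidableEq V] (I : Instance V)

/-- The multiplicities of the edges whose order is free: those of the residual graph, and at a node
without residual edges those of the graph. -/
def freeMult (v w : V) : ℕ :=
  if I.residual.outDegree v = 0 then I.graph.mult (v, w) else I.residual.mult (v, w)

def freeDegree (v : V) : ℕ := ∑ w, I.freeMult v w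

/-- The weights of the last exits. -/
def exitWeight (v w : V) : ℕ :=
  if v = I.start ∨ I.freeDegree v = 0 then (if w = I.start then 1 else 0) else I.freeMult v w

/-- The exit lists at `v` that occur in solutions. -/
def exitLists (v : V) : Finset (List V) :=
  (arrangements fun w => I.graph.mult (v, w)).filter fun l =>
    ∀ w, (v, w) ∈ I.priority → l.head? = some w

theorem residual_mult (e : V × V) :
    I.residual.mult e = if e ∈ I.priority then 0 else I.graph.mult e := rfl

theorem eq_of_mem_priority {v w w' : V} (h : (v, w) ∈ I.priority) (h' : (v, w') ∈ I.priority) :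
    w = w' := by
  have := Finset.card_le_one.1 (I.priority_card_le v) (v, w)
    (by simp [DirectedMultigraph.outEdges, h, I.priority_subset h]) (v, w')
    (by simp [DirectedMultigraph.outEdges, h', I.priority_subset h'])
  exact (Prod.mk.inj this).2

/-- Deleting the priority edge from the front of an exit list turns it into an arrangement of the
free edges, with the same last exit. -/
theorem exists_exitLists_bijection (v : V) : ∃ pre : List V,
    I.exitLists v = (arrangements (I.freeMult v)).image (pre ++ ·) ∧
      ∀ l ∈ arrangements (I.freeMult v), (pre ++ l).getLast? = l.getLast? := by
  by_cases hp : ∃ w, (v, w) ∈ I.priority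
  · obtain ⟨w, hw⟩ := hp
    have hmult : ∀ x, I.graph.mult (v, x) = I.residual.mult (v, x) + if x = w then 1 else 0 := by
      intro x
      rw [residual_mult]
      by_cases hx : x = w
      · subst hx
        simp [hw, I.priority_mult _ hw]
      · have : (v, x) ∉ I.priority := fun h => hx (I.eq_of_mem_priority h hw)
        simp [this, hx]
    have hpr : ∀ x, (v, x) ∈ I.priority ↔ x = w := fun x =>
      ⟨fun h => I.eq_of_mem_priority h hw, fun h => h ▸ hw⟩
    -- If the priority edge is the only edge leaving `v`, stripping it would lose the last exit. It
    -- is then kept as a free edge, and being first is automatic.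
    by_cases h0 : I.residual.outDegree v = 0
    · refine ⟨[], ?_, fun _ _ => rfl⟩
      have hf : I.freeMult v = fun x => I.graph.mult (v, x) := by
        funext x
        rw [freeMult, if_pos h0]
      simp only [List.nil_append, Finset.image_id', exitLists, hf]
      refine Finset.filter_true_of_mem fun l hl x hx => ?_
      rw [hpr] at hx
      subst hx
      have h1 : ∀ y, I.residual.mult (v, y) = 0 := by
        rw [DirectedMultigraph.outDegree_eq_sum] at h0
        exact fun y => Finset.sum_eq_zero_iff.1 h0 y (Finset.mem_univ y)
      have h2 := mem_arrangements.1 hl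
      simp only [hmult, h1, zero_add] at h2
      cases l with
      | nil => simpa using h2 x
      | cons y l =>
        by_contra h
        have h3 : y ≠ x := fun h' => h (by rw [h']; rfl)
        have := h2 y
        rw [if_neg h3, List.count_cons_self] at this
        omega
    · have hf : I.freeMult v = fun x => I.residual.mult (v, x) := by
        funext x
        rw [freeMult, if_neg h0]
      refine ⟨[w], ?_, ?_⟩
      · ext l
        simp only [exitLists, Finset.mem_filter, mem_arrangements, hmult, hpr, forall_eq,
          Finset.mem_image, hf]
        constructor
        · rintro ⟨h1, h2⟩
          obtain ⟨t, rfl⟩ : ∃ t, l = w :: t := by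
            cases l with
            | nil => simp at h2
            | cons y t =>
              simp only [List.head?_cons, Option.some.injEq] at h2
              exact ⟨t, by rw [h2]⟩
          refine ⟨t, fun x => ?_, rfl⟩
          have := h1 x
          rw [List.count_cons] at this
          simp only [beq_iff_eq, eq_comm (a := w)] at this
          omega
        · rintro ⟨t, h1, rfl⟩
          refine ⟨fun x => ?_, rfl⟩
          rw [List.singleton_append, List.count_cons, h1]
          simp only [beq_iff_eq, eq_comm (a := w)]
      · intro l hl
        have hne : l ≠ [] := by
          rintro rfl
          have := length_of_mem_arrangements hl
          rw [hf, ← DirectedMultigraph.outDegree_eq_sum] at this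
          exact h0 this.symm
        rw [List.getLast?_append_of_ne_nil _ hne]
  · push Not at hp
    refine ⟨[], ?_, fun _ _ => rfl⟩
    have hf : I.freeMult v = fun x => I.graph.mult (v, x) := by
      funext x
      rw [freeMult, residual_mult, if_neg (hp x), ite_self]
    simp only [List.nil_append, Finset.image_id', exitLists, hf]
    exact Finset.filter_true_of_mem fun l hl x hx => absurd hx (hp x)

theorem card_exitLists_lastExit (v x : V) :
    ((I.exitLists v).filter fun l =>
        (if v = I.start then I.start else l.getLast?.getD I.start) = x).card *
      ∏ w, (I.freeMult v w).factorial =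
    (if v = I.start then (I.freeDegree v).factorial else (I.freeDegree v - 1).factorial) *
      I.exitWeight v x := by
  obtain ⟨pre, h1, h2⟩ := I.exists_exitLists_bijection v
  have hinj : Function.Injective fun l : List V => pre ++ l := fun a b h =>
    List.append_cancel_left h
  have h3 : ((I.exitLists v).filter fun l =>
        (if v = I.start then I.start else l.getLast?.getD I.start) = x).card =
      ((arrangements (I.freeMult v)).filter fun l =>
        (if v = I.start then I.start else l.getLast?.getD I.start) = x).card := by
    rw [h1, Finset.filter_image, Finset.card_image_of_injective _ hinj]
    congr 1
    refine Finset.filter_congr fun l hl => ?_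
    rw [h2 l hl]
  rw [h3]
  by_cases hv : v = I.start
  · simp only [hv, if_true, exitWeight, true_or]
    by_cases hx : x = I.start
    · simp only [hx, if_true, Finset.filter_true, mul_one]
      exact card_arrangements_mul _
    · simp [hx, Ne.symm hx]
  · simp only [hv, if_false, exitWeight, false_or]
    -- The only list is empty, and the default value `I.start` of the last exit agrees with the unit
    -- weight in `exitWeight`.
    by_cases hd : I.freeDegree v = 0
    · have h4 : ∀ l ∈ arrangements (I.freeMult v), l = [] := by
        intro l hl
        rw [← List.length_eq_zero_iff, length_of_mem_arrangements hl]
        exact hd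
      have h5 : (arrangements (I.freeMult v)).filter (fun l => l.getLast?.getD I.start = x) =
          (arrangements (I.freeMult v)).filter (fun _ => I.start = x) := by
        refine Finset.filter_congr fun l hl => ?_
        rw [h4 l hl]
        rfl
      have h6 := card_arrangements_mul (I.freeMult v)
      rw [h5, hd]
      change _ = (I.freeDegree v).factorial at h6
      by_cases hx : x = I.start
      · simp only [hx, if_true, Finset.filter_true, mul_one]
        rw [h6, hd]
      · simp [hx, Ne.symm hx]
    · have h5 : (arrangements (I.freeMult v)).filter (fun l => l.getLast?.getD I.start = x) =
          (arrangements (I.freeMult v)).filter (fun l => l.getLast? = some x) := by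
        refine Finset.filter_congr fun l hl => ?_
        have hne : l ≠ [] := by
          rintro rfl
          exact hd (length_of_mem_arrangements hl).symm
        rw [List.getLast?_eq_some_getLast hne]
        simp
      rw [h5, card_arrangements_getLast_mul, if_neg hd]
      rfl

-- Split by the map `f` of last exits: for fixed `f` the lists at different nodes are independent,
-- and their numbers multiply.
open Classical in
theorem card_piFinset_exitLists :
    ((Fintype.piFinset I.exitLists).filter fun l => LeadsTo (lastExit l I.start) I.start).card *
      ∏ v, ∏ w, (I.freeMult v w).factorial =
    (∏ v, if v = I.start then (I.freeDegree v).factorial else (I.freeDegree v - 1).factorial) *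
      ∑ f : V → V with LeadsTo f I.start, ∏ v, I.exitWeight v (f v) := by
  rw [Finset.card_eq_sum_card_fiberwise (f := fun l => lastExit l I.start)
    (t := Finset.univ.filter fun f => LeadsTo f I.start) (fun l hl => by
      simpa using (Finset.mem_filter.1 hl).2), Finset.sum_mul, Finset.mul_sum]
  refine Finset.sum_congr rfl fun f hf => ?_
  rw [← Finset.prod_mul_distrib]
  simp only [← I.card_exitLists_lastExit]
  rw [Finset.prod_mul_distrib, ← Fintype.card_piFinset]
  congr 2
  ext l
  simp only [Finset.mem_filter, Fintype.mem_piFinset]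
  constructor
  · rintro ⟨⟨h1, -⟩, h3⟩ v
    exact ⟨h1 v, congrFun h3 v⟩
  · intro h
    have h1 : lastExit l I.start = f := funext fun v => (h v).2
    refine ⟨⟨fun v => (h v).1, ?_⟩, h1⟩
    rw [h1]
    exact (Finset.mem_filter.1 hf).2

/-- Multiplicities and priorities become conditions on the single exit lists; the only global
condition left is that the edges form a closed walk. -/
theorem mem_solutions_iff {p : List (V × V)} :
    p ∈ I.solutions ↔ IsPath Finset.univ I.start p I.start ∧ ∀ v, exits p v ∈ I.exitLists v := by
  have hpath : ∀ {E E' : Finset (V × V)} {u w : V} {p : List (V × V)}, IsPath E u p w →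
      (∀ e ∈ p, e ∈ E') → IsPath E' u p w := by
    intro E E' u w p h hE
    induction p generalizing u with
    | nil => exact h
    | cons e p ih =>
      obtain ⟨-, h1, h2⟩ := h
      exact ⟨hE e List.mem_cons_self, h1, ih h2 fun x hx => hE x (List.mem_cons_of_mem _ hx)⟩
  have hc : (I.graph.IsEulerianCycle I.start p) ↔
      IsPath Finset.univ I.start p I.start ∧ ∀ v w, (exits p v).count w = I.graph.mult (v, w) := by
    simp only [count_exits]
    constructor
    · rintro ⟨h1, h2⟩
      refine ⟨hpath h1 fun _ _ => Finset.mem_univ _, fun v w => ?_⟩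
      by_cases h : (v, w) ∈ I.graph.edges
      · convert h2 _ h
      · rw [List.count_eq_zero.2 fun h' => h (h1.subset _ h')]
        simp only [DirectedMultigraph.edges, Finset.mem_filter, Finset.mem_univ, true_and] at h
        omega
    · rintro ⟨h1, h2⟩
      refine ⟨hpath h1 fun e he => ?_, fun e _ => ?_⟩
      · simp only [DirectedMultigraph.edges, Finset.mem_filter, Finset.mem_univ, true_and]
        rw [← h2 e.1 e.2]
        exact List.count_pos_iff.2 he
      · convert h2 e.1 e.2
  simp only [solutions, Set.mem_ofPred_eq, hc, exitLists, Finset.mem_filter, mem_arrangements,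
    forall_and, and_assoc]
  refine and_congr_right fun _ => and_congr_right fun h2 => ?_
  constructor
  · intro h v w hvw
    refine (respects_at_iff (f := (v, w)) ?_).1 (h _ hvw)
    rw [← count_exits, h2]
    exact I.priority_mult _ hvw
  · intro h f hf
    refine (respects_at_iff ?_).2 (h f.1 f.2 hf)
    have := h2 f.1 f.2
    rw [count_exits] at this
    rw [show f = (f.1, f.2) from rfl, this]
    exact I.priority_mult _ hf

theorem degreeBalanced_of_mem_exitLists (hb : I.graph.Balanced) {l : V → List V}
    (hl : ∀ v, l v ∈ I.exitLists v) : DegreeBalanced l I.start I.start := by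
  have h : ∀ v, l v ∈ arrangements fun w => I.graph.mult (v, w) := fun v =>
    (Finset.mem_filter.1 (hl v)).1
  intro v
  rw [length_of_mem_arrangements (h v), ← DirectedMultigraph.outDegree_eq_sum, ← hb v,
    DirectedMultigraph.inDegree_eq_sum]
  simp only [mem_arrangements.1 (h _)]

theorem count_eq_zero_of_not_balanced (hb : ¬ I.graph.Balanced) : I.count = 0 := by
  rw [count, Set.ncard_eq_zero I.solutions_finite, Set.eq_empty_iff_forall_notMem]
  intro p hp
  rw [mem_solutions_iff] at hp
  refine hb fun v => ?_
  have h : ∀ v, exits p v ∈ arrangements fun w => I.graph.mult (v, w) := fun v =>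
    (Finset.mem_filter.1 (hp.2 v)).1
  have h1 := hp.1.degreeBalanced v
  rw [length_of_mem_arrangements (h v)] at h1
  simp only [mem_arrangements.1 (h _)] at h1
  rw [DirectedMultigraph.outDegree_eq_sum, DirectedMultigraph.inDegree_eq_sum]
  omega

-- The map `exits` is a bijection from the solutions onto the admissible families of lists.
open Classical in
theorem count_eq_card (hb : I.graph.Balanced) : I.count =
    ((Fintype.piFinset I.exitLists).filter fun l =>
      LeadsTo (lastExit l I.start) I.start).card := by
  rw [count, ← Set.ncard_coe_finset]
  refine Set.ncard_congr (fun p _ => exits p) ?_ ?_ ?_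
  · intro p hp
    rw [mem_solutions_iff] at hp
    simp only [Finset.coe_filter, Fintype.mem_piFinset, Set.mem_ofPred_eq]
    exact ⟨hp.2, (lastExitReaches_iff_leadsTo hp.1.degreeBalanced).1 hp.1.lastExitReaches⟩
  · intro p q hp hq h
    rw [mem_solutions_iff] at hp hq
    exact hp.1.eq_of_exits_eq hq.1 h
  · intro l hl
    simp only [Finset.coe_filter, Fintype.mem_piFinset, Set.mem_ofPred_eq] at hl
    have hbal := I.degreeBalanced_of_mem_exitLists hb hl.1
    obtain ⟨p, hp, rfl⟩ := exists_walk_of_balanced l _ _ hbal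
      ((lastExitReaches_iff_leadsTo hbal).2 hl.2)
    exact ⟨p, I.mem_solutions_iff.2 ⟨hp, hl.1⟩, rfl⟩

open Classical in
/-- The modified BEST theorem, without any condition on the residual graph. -/
theorem count_mul_prod_factorial (hb : I.graph.Balanced) :
    I.count * ∏ v, ∏ w, (I.freeMult v w).factorial =
    (∏ v, if v = I.start then (I.freeDegree v).factorial else (I.freeDegree v - 1).factorial) *
      ∑ f : V → V with LeadsTo f I.start, ∏ v, I.exitWeight v (f v) := by
  rw [I.count_eq_card hb, card_piFinset_exitLists]

/-- The Laplacian of the last exits, with the row of the start node replaced by a unit vector. -/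
def exitLaplacian : Matrix V V ℤ := Matrix.of fun v w =>
  (if v = w then ((∑ x, I.exitWeight v x : ℕ) : ℤ) else 0) -
    if v ≠ I.start then (I.exitWeight v w : ℤ) else 0

theorem count_mul_prod_factorial_eq_det (hb : I.graph.Balanced) :
    (I.count : ℤ) * ∏ v, ∏ w, ((I.freeMult v w).factorial : ℤ) =
    (∏ v, if v = I.start then ((I.freeDegree v).factorial : ℤ)
      else ((I.freeDegree v - 1).factorial : ℤ)) * I.exitLaplacian.det := by
  classical
  have h := det_eq_sum_leadsTo (fun v w => (I.exitWeight v w : ℤ)) I.start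
    (fun w => by simp [exitWeight])
  have h2 := congrArg (Nat.cast (R := ℤ)) (I.count_mul_prod_factorial hb)
  push_cast at h2
  rw [← h] at h2
  rw [h2, exitLaplacian]
  push_cast
  rfl

theorem count_eq_bestFormula (hb : I.graph.Balanced)
    (hne : ∀ v, (I.residual.outEdges v).Nonempty) : (I.count : ℚ) = I.bestFormula := by
  classical
  have hpos : ∀ v, I.residual.outDegree v ≠ 0 := by
    intro v
    obtain ⟨e, he⟩ := hne v
    refine (Finset.sum_pos (fun e he => ?_) ⟨e, he⟩).ne'
    simp only [DirectedMultigraph.outEdges, DirectedMultigraph.edges, Finset.mem_filter] at he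
    exact he.1.2
  have hm : ∀ v w, I.freeMult v w = I.residual.mult (v, w) := fun v w => by
    rw [freeMult, if_neg (hpos v)]
  have hd : ∀ v, I.freeDegree v = I.residual.outDegree v := fun v => by
    rw [freeDegree, DirectedMultigraph.outDegree_eq_sum]
    exact Finset.sum_congr rfl fun w _ => hm v w
  have hw : ∀ v w, I.exitWeight v w = I.residual.rootedWeight I.start v w := by
    intro v w
    simp [exitWeight, hd, hpos, hm, DirectedMultigraph.rootedWeight]
  have h := I.count_mul_prod_factorial hb
  simp only [hm, hd, hw] at h
  rw [← DirectedMultigraph.weightedTreeCount_eq_sum_leadsTo] at h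
  have hprod : (∏ v, if v = I.start then (I.residual.outDegree v).factorial
      else (I.residual.outDegree v - 1).factorial) =
      I.residual.outDegree I.start * ∏ v, (I.residual.outDegree v - 1).factorial := by
    rw [← Finset.mul_prod_erase _ _ (Finset.mem_univ I.start),
      ← Finset.mul_prod_erase _ (fun v => (I.residual.outDegree v - 1).factorial)
        (Finset.mem_univ I.start), if_pos rfl, ← mul_assoc, Nat.mul_factorial_pred (hpos _)]
    congr 1
    exact Finset.prod_congr rfl fun v hv => if_neg (Finset.ne_of_mem_erase hv)
  rw [hprod] at h
  have hout : ∀ v, ∏ e ∈ I.residual.outEdges v, ((I.residual.mult e).factorial : ℚ) =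
      ∏ w, ((I.residual.mult (v, w)).factorial : ℚ) := by
    intro v
    -- In `Additive ℚ` the sum is a product, and non-edges contribute `0! = 1`.
    have h1 := I.residual.sum_outEdges (M := Additive ℚ) v
      (fun e => Additive.ofMul ((I.residual.mult e).factorial : ℚ)) (fun e he => by simp [he])
    exact h1
  have hne0 : (∏ v, ∏ w, ((I.residual.mult (v, w)).factorial : ℚ)) ≠ 0 :=
    Finset.prod_ne_zero_iff.2 fun v _ => Finset.prod_ne_zero_iff.2 fun w _ =>
      Nat.cast_ne_zero.2 (Nat.factorial_ne_zero _)
  have h2 := congrArg (Nat.cast (R := ℚ)) h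
  push_cast at h2
  rw [bestFormula, Finset.prod_div_distrib, Finset.prod_congr rfl fun v _ => hout v]
  rw [mul_div_assoc', div_mul_eq_mul_div, eq_div_iff hne0]
  exact h2

end Instance

/-! ### Bit lengths and the cost of nested loops -/

section Cost

/-- A store all of whose entries have bit length at most `K`. -/
def Store.Fits (s : Store) (K : ℕ) : Prop :=
  (∀ x, bitLength (s.reg x) ≤ K) ∧ ∀ a i, bitLength (s.arr a i) ≤ K

/-- A factor that bounds the growth of bit lengths when an expression is evaluated. -/
def Expr.growth : Expr → ℕ
  | const z => bitLength z
  | reg _ => 1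
  | load _ _ => 1
  | add e f => e.growth + f.growth
  | sub e f => e.growth + f.growth
  | mul e f => e.growth + f.growth
  | div e f => e.growth + f.growth

/-- A factor that bounds the cost of an expression in terms of bit lengths. -/
def Expr.costFactor : Expr → ℕ
  | const z => bitLength z + 1
  | reg _ => 2
  | load _ i => i.costFactor + i.growth + 2
  | add e f => e.costFactor + f.costFactor + e.growth + f.growth + 1
  | sub e f => e.costFactor + f.costFactor + e.growth + f.growth + 1
  | mul e f => e.costFactor + f.costFactor + e.growth + f.growth + 1
  | div e f => e.costFactor + f.costFactor + e.growth + f.growth + 1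

theorem bitLength_le_iff {z : ℤ} {k : ℕ} : bitLength z ≤ k + 1 ↔ z.natAbs < 2 ^ k := by
  rw [bitLength, Nat.add_le_add_iff_right, Nat.size_le]

theorem natAbs_lt_two_pow_bitLength (z : ℤ) : z.natAbs < 2 ^ (bitLength z - 1) := by
  rw [bitLength, Nat.add_sub_cancel]
  exact Nat.lt_size_self _

theorem one_le_bitLength (z : ℤ) : 1 ≤ bitLength z := Nat.le_add_left _ _

/-- Serves addition, subtraction and division. One of the two sign bits on the right pays for the
carry. -/
theorem bitLength_le_add_of_natAbs_le_add {x y z : ℤ} (h : z.natAbs ≤ x.natAbs + y.natAbs) :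
    bitLength z ≤ bitLength x + bitLength y := by
  obtain ⟨a, ha⟩ := Nat.exists_eq_add_of_le (one_le_bitLength x)
  obtain ⟨b, hb⟩ := Nat.exists_eq_add_of_le (one_le_bitLength y)
  have hx := natAbs_lt_two_pow_bitLength x
  have hy := natAbs_lt_two_pow_bitLength y
  rw [ha, Nat.add_sub_cancel_left] at hx
  rw [hb, Nat.add_sub_cancel_left] at hy
  rw [ha, hb, show 1 + a + (1 + b) = (a + b + 1) + 1 by ring, bitLength_le_iff]
  have h1 : 2 ^ a ≤ 2 ^ (a + b) := Nat.pow_le_pow_right (by norm_num) (by omega)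
  have h2 : 2 ^ b ≤ 2 ^ (a + b) := Nat.pow_le_pow_right (by norm_num) (by omega)
  rw [pow_succ]
  omega

theorem bitLength_mul_le (x y : ℤ) : bitLength (x * y) ≤ bitLength x + bitLength y := by
  obtain ⟨a, ha⟩ := Nat.exists_eq_add_of_le (one_le_bitLength x)
  obtain ⟨b, hb⟩ := Nat.exists_eq_add_of_le (one_le_bitLength y)
  have hx := natAbs_lt_two_pow_bitLength x
  have hy := natAbs_lt_two_pow_bitLength y
  rw [ha, Nat.add_sub_cancel_left] at hx
  rw [hb, Nat.add_sub_cancel_left] at hy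
  rw [ha, hb, show 1 + a + (1 + b) = (a + b + 1) + 1 by ring, bitLength_le_iff, Int.natAbs_mul]
  calc x.natAbs * y.natAbs < 2 ^ a * 2 ^ b := Nat.mul_lt_mul'' hx hy
    _ = 2 ^ (a + b) := (pow_add _ _ _).symm
    _ ≤ 2 ^ (a + b + 1) := Nat.pow_le_pow_right (by norm_num) (by omega)

theorem Expr.bitLength_eval_le {s : Store} {K : ℕ} (hs : s.Fits K) (hK : 1 ≤ K) (e : Expr) :
    bitLength (e.eval s) ≤ e.growth * K := by
  induction e with
  | const z => exact Nat.le_mul_of_pos_right _ hK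
  | reg x => simpa [growth, eval] using hs.1 x
  | load a i _ => simpa [growth, eval] using hs.2 a _
  | add e f he hf =>
    rw [growth, add_mul]
    exact (bitLength_le_add_of_natAbs_le_add (Int.natAbs_add_le _ _)).trans (add_le_add he hf)
  | sub e f he hf =>
    rw [growth, add_mul]
    exact (bitLength_le_add_of_natAbs_le_add (Int.natAbs_sub_le _ _)).trans (add_le_add he hf)
  | mul e f he hf =>
    rw [growth, add_mul]
    exact (bitLength_mul_le _ _).trans (add_le_add he hf)
  | div e f he hf =>
    rw [growth, add_mul]
    exact (bitLength_le_add_of_natAbs_le_add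
      ((Int.natAbs_ediv_le_natAbs _ _).trans (Nat.le_add_right _ _))).trans (add_le_add he hf)

theorem Expr.cost_le {s : Store} {K : ℕ} (hs : s.Fits K) (hK : 1 ≤ K) (e : Expr) :
    e.cost s ≤ e.costFactor * K := by
  induction e with
  | const z => exact Nat.le_mul_of_pos_right _ hK
  | reg x =>
    have := hs.1 x
    simp only [cost, costFactor]
    omega
  | load a i hi =>
    have h1 := i.bitLength_eval_le hs hK
    have h2 := hs.2 a (i.eval s)
    simp only [cost, costFactor, add_mul]
    omega
  | add e f he hf | sub e f he hf | mul e f he hf | div e f he hf =>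
    have h1 := e.bitLength_eval_le hs hK
    have h2 := f.bitLength_eval_le hs hK
    simp only [cost, costFactor, add_mul]
    omega

theorem Exec.assign_le {s : Store} {K : ℕ} (hs : s.Fits K) (hK : 1 ≤ K) (x : ℕ) (e : Expr) {z : ℤ}
    (hz : e.eval s = z) : ∃ c, Exec (.assign x e) s (s.setReg x z) c ∧
      c ≤ (e.costFactor + e.growth + 1) * K := by
  subst hz
  refine ⟨_, .assign s x e, ?_⟩
  have h1 := e.bitLength_eval_le hs hK
  have h2 := e.cost_le hs hK
  simp only [add_mul]
  omega

theorem Exec.store_le {s : Store} {K : ℕ} (hs : s.Fits K) (hK : 1 ≤ K) (a : ℕ) (i e : Expr)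
    {j z : ℤ} (hj : i.eval s = j) (hz : e.eval s = z) :
    ∃ c, Exec (.store a i e) s (s.setArr a j z) c ∧
      c ≤ (i.costFactor + e.costFactor + i.growth + e.growth + 1) * K := by
  subst hz hj
  refine ⟨_, .store s a i e, ?_⟩
  have h1 := e.bitLength_eval_le hs hK
  have h2 := e.cost_le hs hK
  have h3 := i.bitLength_eval_le hs hK
  have h4 := i.cost_le hs hK
  simp only [add_mul]
  omega

/-- Add up the values of `e` for all values of register `2` below `L`, in register `3`. -/
def sumLoop (L e : Expr) : Program :=
  .loop (.sub L (.reg 2))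
    (.seq (.assign 3 (.add (.reg 3) e)) (.assign 2 (.add (.reg 2) (.const 1))))

/-- For each index `i < N`, held in register `1`, put the sum of the values of `e` over all
`l < L`, where `l` is held in register `2`, into register `3` and assign `g` to cell `i` of the
array `a`. -/
def sumFill (a : ℕ) (N L e g : Expr) : Program :=
  .seq (.assign 1 (.const 0)) (.loop (.sub N (.reg 1))
    (.seq (.assign 3 (.const 0)) (.seq (.assign 2 (.const 0)) (.seq (sumLoop L e)
      (.seq (.store a (.reg 1) g) (.assign 1 (.add (.reg 1) (.const 1))))))))

/-- Registers that are at most `B` in absolute value. -/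
def RegLe (B : ℕ) (reg : ℕ → ℤ) : Prop := ∀ x, |reg x| ≤ B

theorem RegLe.update {B : ℕ} {reg : ℕ → ℤ} (h : RegLe B reg) (x : ℕ) {z : ℤ} (hz : |z| ≤ B) :
    RegLe B (Function.update reg x z) := by
  intro y
  by_cases hy : y = x
  · subst hy
    rwa [Function.update_self]
  · rw [Function.update_of_ne hy]
    exact h y

theorem fits_mk {B K : ℕ} (hBK : ∀ z : ℤ, |z| ≤ B → bitLength z ≤ K) {reg : ℕ → ℤ}
    {A : ℕ → ℤ → ℤ} (hreg : RegLe B reg) (hA : ∀ b j, |A b j| ≤ B) : (Store.mk reg A).Fits K :=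
  ⟨fun x => hBK _ (hreg x), fun b j => hBK _ (hA b j)⟩

/-- The constant `C` depends only on the program text. Of the bounds, `B` limits values, `K` bit
lengths and `M` the number of rounds; the invariant is that register 3 holds a partial sum. -/
theorem exec_sumLoop (L e : Expr) : ∃ C : ℕ, ∀ (B K M : ℕ) (A : ℕ → ℤ → ℤ) (i Lv : ℕ) (ev : ℕ → ℤ),
    (∀ z : ℤ, |z| ≤ B → bitLength z ≤ K) → (∀ b j, |A b j| ≤ B) → M ≤ B → Lv ≤ M →
    (∀ reg : ℕ → ℤ, reg 1 = i → L.eval ⟨reg, A⟩ = Lv) →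
    (∀ (reg : ℕ → ℤ) (l : ℕ), l < Lv → reg 1 = i → reg 2 = l → e.eval ⟨reg, A⟩ = ev l) →
    (∀ l ≤ Lv, |∑ j ∈ Finset.range l, ev j| ≤ B) →
    ∀ reg, RegLe B reg → reg 1 = i → reg 2 = 0 → reg 3 = 0 →
    ∃ reg' c, Exec (sumLoop L e) ⟨reg, A⟩ ⟨reg', A⟩ c ∧ RegLe B reg' ∧ reg' 1 = i ∧
      reg' 3 = ∑ j ∈ Finset.range Lv, ev j ∧ c ≤ C * (M + 1) * K := by
  set Cg := (Expr.sub L (.reg 2)).costFactor with hCg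
  set Ca := (Expr.add (.reg 3) e).costFactor + (Expr.add (.reg 3) e).growth + 1 with hCa
  set Cb := (Expr.add (.reg 2) (.const 1)).costFactor +
    (Expr.add (.reg 2) (.const 1)).growth + 1 with hCb
  refine ⟨Cg + 1 + Ca + Cb, ?_⟩
  intro B K M A i Lv ev hBK hA hMB hLM hL he hsum reg hreg h1 h2 h3
  have hK : 1 ≤ K := (one_le_bitLength 0).trans (hBK 0 (by simp))
  suffices h : ∀ d l, l + d = Lv → ∀ reg, RegLe B reg → reg 1 = i → reg 2 = l →
      reg 3 = ∑ j ∈ Finset.range l, ev j →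
      ∃ reg' c, Exec (sumLoop L e) ⟨reg, A⟩ ⟨reg', A⟩ c ∧ RegLe B reg' ∧ reg' 1 = i ∧
      reg' 3 = ∑ j ∈ Finset.range Lv, ev j ∧ c ≤ (Cg + 1 + Ca + Cb) * (d + 1) * K by
    obtain ⟨reg', c, h4, h5, h6, h7, h8⟩ := h Lv 0 (by simp) reg hreg h1 h2 (by simpa using h3)
    refine ⟨reg', c, h4, h5, h6, h7, h8.trans ?_⟩
    gcongr
  intro d
  induction d with
  | zero =>
    intro l hl reg hreg h1 h2 h3
    have hf := fits_mk hBK hreg hA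
    refine ⟨reg, _, .loop_neg ?_, hreg, h1, ?_, ?_⟩
    · simp only [Expr.eval, hL reg h1, h2]
      omega
    · rw [h3, ← hl, add_zero]
    · have := (Expr.sub L (.reg 2)).cost_le hf hK
      rw [← hCg] at this
      simp only [zero_add, mul_one, add_mul]
      omega
  | succ d ih =>
    intro l hl reg hreg h1 h2 h3
    have hf := fits_mk hBK hreg hA
    have hb1 : |∑ j ∈ Finset.range (l + 1), ev j| ≤ B := hsum _ (by omega)
    have hb2 : |((l + 1 : ℕ) : ℤ)| ≤ B := by
      rw [abs_of_nonneg (by positivity)]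
      exact_mod_cast (by omega : l + 1 ≤ B)
    obtain ⟨c1, hc1, hc1'⟩ := Exec.assign_le hf hK 3 (.add (.reg 3) e)
      (z := ∑ j ∈ Finset.range (l + 1), ev j) (by
        simp only [Expr.eval, h3, he reg l (by omega) h1 h2, Finset.sum_range_succ])
    set reg1 := Function.update reg 3 (∑ j ∈ Finset.range (l + 1), ev j) with hreg1
    have hr1 : RegLe B reg1 := hreg.update 3 hb1
    obtain ⟨c2, hc2, hc2'⟩ := Exec.assign_le (fits_mk hBK hr1 hA) hK 2 (.add (.reg 2) (.const 1))
      (z := ((l + 1 : ℕ) : ℤ)) (by simp [Expr.eval, hreg1, h2])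
    obtain ⟨reg', c, h4, h5, h6, h7, h8⟩ := ih (l + 1) (by omega)
      (Function.update reg1 2 ((l + 1 : ℕ) : ℤ)) (hr1.update 2 hb2) (by simp [hreg1, h1])
      (by simp) (by simp [hreg1])
    refine ⟨reg', _, .loop_pos ?_ (.seq hc1 hc2) h4, h5, h6, h7, ?_⟩
    · simp only [Expr.eval, hL reg h1, h2]
      omega
    · have h9 := (Expr.sub L (.reg 2)).cost_le hf hK
      rw [← hCg] at h9
      rw [← hCa] at hc1'
      rw [← hCb] at hc2'
      rw [mul_add, add_mul, mul_one]
      refine (add_comm _ _).trans_le (add_le_add h8 ?_)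
      simp only [add_mul]
      omega

/-- `A i` describes the arrays once `i` cells are filled. At most `M` cells with at most `M`
summands each account for the factor `(M + 1) ^ 2`. -/
theorem exec_sumFill (N L e g : Expr) : ∃ C : ℕ, ∀ (a B K M : ℕ) (A : ℕ → ℕ → ℤ → ℤ) (Nv : ℕ)
    (Lv : ℕ → ℕ) (ev : ℕ → ℕ → ℤ) (f : ℕ → ℤ),
    (∀ z : ℤ, |z| ≤ B → bitLength z ≤ K) → (∀ i b j, |A i b j| ≤ B) →
    M ≤ B → Nv ≤ M → (∀ i < Nv, Lv i ≤ M) →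
    (∀ i < Nv, Function.update (A i) a (Function.update (A i a) i (f i)) = A (i + 1)) →
    (∀ (reg : ℕ → ℤ) (i : ℕ), i ≤ Nv → N.eval ⟨reg, A i⟩ = Nv) →
    (∀ (reg : ℕ → ℤ) (i : ℕ), i < Nv → reg 1 = i → L.eval ⟨reg, A i⟩ = Lv i) →
    (∀ (reg : ℕ → ℤ) (i l : ℕ), i < Nv → l < Lv i → reg 1 = i → reg 2 = l →
      e.eval ⟨reg, A i⟩ = ev i l) →
    (∀ (reg : ℕ → ℤ) (i : ℕ), i < Nv → reg 1 = i →
      reg 3 = ∑ l ∈ Finset.range (Lv i), ev i l → g.eval ⟨reg, A i⟩ = f i) →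
    (∀ i < Nv, ∀ l ≤ Lv i, |∑ j ∈ Finset.range l, ev i j| ≤ B) →
    ∀ reg, RegLe B reg →
    ∃ reg' c, Exec (sumFill a N L e g) ⟨reg, A 0⟩ ⟨reg', A Nv⟩ c ∧ RegLe B reg' ∧
      c ≤ C * (M + 1) ^ 2 * K := by
  obtain ⟨C0, hC0⟩ := exec_sumLoop L e
  set Cg := (Expr.sub N (.reg 1)).costFactor with hCg
  set Cz := (Expr.const 0).costFactor + (Expr.const 0).growth + 1 with hCz
  set Cs := (Expr.reg 1).costFactor + g.costFactor + (Expr.reg 1).growth + g.growth + 1 with hCs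
  set Cb := (Expr.add (.reg 1) (.const 1)).costFactor +
    (Expr.add (.reg 1) (.const 1)).growth + 1 with hCb
  refine ⟨Cz + (Cg + 1 + Cz + Cz + C0 + Cs + Cb), ?_⟩
  intro a B K M A Nv Lv ev f hBK hA hMB hNM hLM hstep hN hL he hg hsum reg hreg
  have hK : 1 ≤ K := (one_le_bitLength 0).trans (hBK 0 (by simp))
  have h0 : |(0 : ℤ)| ≤ B := by simp
  suffices h : ∀ d i, i + d = Nv → ∀ reg, RegLe B reg → reg 1 = i →
      ∃ reg' c, Exec (.loop (.sub N (.reg 1))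
        (.seq (.assign 3 (.const 0)) (.seq (.assign 2 (.const 0)) (.seq (sumLoop L e)
        (.seq (.store a (.reg 1) g) (.assign 1 (.add (.reg 1) (.const 1))))))))
        ⟨reg, A i⟩ ⟨reg', A Nv⟩ c ∧ RegLe B reg' ∧
        c ≤ (Cg + 1 + Cz + Cz + C0 + Cs + Cb) * (d + 1) * ((M + 1) * K) by
    obtain ⟨c1, hc1, hc1'⟩ := Exec.assign_le (fits_mk hBK hreg (hA 0)) hK 1 (.const 0)
      (z := 0) rfl
    obtain ⟨reg', c, h4, h5, h8⟩ := h Nv 0 (by simp) (Function.update reg 1 0)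
      (hreg.update 1 h0) (by simp)
    refine ⟨reg', _, .seq hc1 h4, h5, ?_⟩
    rw [add_mul, add_mul]
    refine add_le_add (hc1'.trans ?_) (h8.trans ?_)
    · refine Nat.mul_le_mul_right K (Nat.le_mul_of_pos_right _ (by positivity))
    · rw [mul_assoc, mul_assoc, pow_two, mul_assoc]
      gcongr
  intro d
  induction d with
  | zero =>
    intro i hi reg hreg h1
    have hf := fits_mk hBK hreg (hA i)
    obtain rfl : i = Nv := hi
    refine ⟨reg, _, .loop_neg ?_, hreg, ?_⟩
    · simp only [Expr.eval, hN reg i le_rfl, h1]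
      omega
    · have h2 := (Expr.sub N (.reg 1)).cost_le hf hK
      rw [← hCg] at h2
      have h3 : K ≤ (M + 1) * K := Nat.le_mul_of_pos_left _ (by positivity)
      have h4 : Cg * K ≤ Cg * ((M + 1) * K) := Nat.mul_le_mul_left _ h3
      simp only [zero_add, mul_one, add_mul (c := (M + 1) * K), one_mul]
      omega
  | succ d ih =>
    intro i hi reg hreg h1
    have hi' : i < Nv := by omega
    have hf := fits_mk hBK hreg (hA i)
    obtain ⟨c1, hc1, hc1'⟩ := Exec.assign_le hf hK 3 (.const 0) (z := 0) rfl
    set reg1 := Function.update reg 3 0 with hreg1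
    have hr1 : RegLe B reg1 := hreg.update 3 h0
    obtain ⟨c2, hc2, hc2'⟩ := Exec.assign_le (fits_mk hBK hr1 (hA i)) hK 2 (.const 0)
      (z := 0) rfl
    set reg2 := Function.update reg1 2 0 with hreg2
    have hr2 : RegLe B reg2 := hr1.update 2 h0
    obtain ⟨reg3, c3, hc3, hr3, h31, h33, hc3'⟩ := hC0 B K M (A i) i (Lv i) (ev i) hBK (hA i) hMB
      (hLM i hi') (fun reg h => hL reg i hi' h) (fun reg l hl h h' => he reg i l hi' hl h h')
      (hsum i hi') reg2 hr2 (by simp [hreg2, hreg1, h1]) (by simp [hreg2])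
      (by simp [hreg2, hreg1])
    obtain ⟨c4, hc4, hc4'⟩ := Exec.store_le (fits_mk hBK hr3 (hA i)) hK a (.reg 1) g
      (j := i) (z := f i) h31 (hg reg3 i hi' h31 h33)
    have hA4 : (Store.mk reg3 (A i)).setArr a i (f i) = ⟨reg3, A (i + 1)⟩ := by
      rw [← hstep i hi']
      rfl
    rw [hA4] at hc4
    have hb2 : |((i + 1 : ℕ) : ℤ)| ≤ B := by
      rw [abs_of_nonneg (by positivity)]
      exact_mod_cast (by omega : i + 1 ≤ B)
    obtain ⟨c5, hc5, hc5'⟩ := Exec.assign_le (fits_mk hBK hr3 (hA (i + 1))) hK 1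
      (.add (.reg 1) (.const 1)) (z := ((i + 1 : ℕ) : ℤ)) (by simp [Expr.eval, h31])
    obtain ⟨reg', c, h4, h5, h8⟩ := ih (i + 1) (by omega)
      (Function.update reg3 1 ((i + 1 : ℕ) : ℤ)) (hr3.update 1 hb2) (by simp)
    refine ⟨reg', _, .loop_pos ?_ (.seq hc1 (.seq hc2 (.seq hc3 (.seq hc4 hc5)))) h4, h5, ?_⟩
    · simp only [Expr.eval, hN reg i hi'.le, h1]
      omega
    · have h9 := (Expr.sub N (.reg 1)).cost_le hf hK
      rw [← hCg] at h9
      rw [← hCz] at hc1' hc2'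
      rw [← hCs] at hc4'
      rw [← hCb] at hc5'
      rw [mul_add, add_mul, mul_one]
      refine (add_comm _ _).trans_le (add_le_add h8 ?_)
      have h3 : K ≤ (M + 1) * K := Nat.le_mul_of_pos_left _ (by positivity)
      have hm : ∀ x, x * K ≤ x * ((M + 1) * K) := fun x => Nat.mul_le_mul_left _ h3
      have h10 := hm Cg
      have h11 := hm Cz
      have h12 := hm Cs
      have h13 := hm Cb
      rw [mul_assoc] at hc3'
      simp only [add_mul (c := (M + 1) * K), one_mul]
      omega

end Cost

/-! ### Programs that fill one table after the other -/

section Phases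

/-- Array contents after the arrays before `a` and the first `i` cells of the array `a` have been
filled. -/
def filled (len : ℕ → ℕ) (content : ℕ → ℕ → ℤ) (a i : ℕ) : ℕ → ℤ → ℤ := fun b j =>
  if 0 ≤ j ∧ (b < a ∧ j.toNat < len b ∨ b = a ∧ j.toNat < i) then content b j.toNat else 0

variable {len : ℕ → ℕ} {content : ℕ → ℕ → ℤ} {a i b j : ℕ}

theorem filled_of_lt {z : ℤ} (hz : z = j) (hb : b < a) (hj : j < len b) :
    filled len content a i b z = content b j := by
  subst hz
  simp [filled, hb, hj]

theorem filled_self {z : ℤ} (hz : z = j) (hj : j < i) :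
    filled len content a i a z = content a j := by
  subst hz
  simp [filled, hj]

theorem filled_neg {z : ℤ} (hz : z < 0) : filled len content a i b z = 0 := by
  simp [filled, not_le.2 hz]

theorem filled_succ : Function.update (filled len content a i) a
    (Function.update (filled len content a i a) i (content a i)) =
      filled len content a (i + 1) := by
  funext b z
  by_cases hb : b = a
  · subst hb
    rw [Function.update_self]
    by_cases hz : z = i
    · subst hz
      simp [filled]
    · rw [Function.update_of_ne hz]
      have : (0 ≤ z ∧ z.toNat < i) ↔ (0 ≤ z ∧ z.toNat < i + 1) := by omega
      simp [filled, this]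
  · rw [Function.update_of_ne hb]
    simp [filled, hb]

theorem filled_len : filled len content a (len a) = filled len content (a + 1) 0 := by
  funext b z
  have : (b < a ∧ z.toNat < len b ∨ b = a ∧ z.toNat < len a) ↔ (b < a + 1 ∧ z.toNat < len b) := by
    constructor
    · rintro (h | ⟨rfl, h⟩)
      · exact ⟨by omega, h.2⟩
      · exact ⟨by omega, h⟩
    · rintro ⟨h1, h2⟩
      rcases Nat.lt_succ_iff_lt_or_eq.1 h1 with h | rfl
      · exact Or.inl ⟨h, h2⟩
      · exact Or.inr ⟨rfl, h2⟩
  simp [filled, this]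

/-- The instructions for filling one array with `sumFill`. -/
structure Phase where
  bound : Expr
  sumBound : Expr
  summand : Expr
  value : Expr

/-- Fill one array after the other. -/
def runPhases : ℕ → List Phase → Program
  | _, [] => .skip
  | a, ph :: l => .seq (sumFill a ph.bound ph.sumBound ph.summand ph.value) (runPhases (a + 1) l)

/-- The phase `ph` fills the array `a` with the required contents, without leaving the bounds `B` for
the values and `M` for the numbers of iterations. -/
def Phase.Valid (ph : Phase) (len : ℕ → ℕ) (content : ℕ → ℕ → ℤ) (B M a : ℕ) : Prop :=
  ∃ (Lv : ℕ → ℕ) (ev : ℕ → ℕ → ℤ), len a ≤ M ∧ (∀ i < len a, Lv i ≤ M) ∧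
    (∀ (reg : ℕ → ℤ) (i : ℕ), i ≤ len a →
      ph.bound.eval ⟨reg, filled len content a i⟩ = len a) ∧
    (∀ (reg : ℕ → ℤ) (i : ℕ), i < len a → reg 1 = i →
      ph.sumBound.eval ⟨reg, filled len content a i⟩ = Lv i) ∧
    (∀ (reg : ℕ → ℤ) (i l : ℕ), i < len a → l < Lv i → reg 1 = i → reg 2 = l →
      ph.summand.eval ⟨reg, filled len content a i⟩ = ev i l) ∧
    (∀ (reg : ℕ → ℤ) (i : ℕ), i < len a → reg 1 = i →
      reg 3 = ∑ l ∈ Finset.range (Lv i), ev i l →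
      ph.value.eval ⟨reg, filled len content a i⟩ = content a i) ∧
    ∀ i < len a, ∃ T : ℕ, (∀ l < Lv i, |ev i l| ≤ T) ∧ Lv i * T ≤ B

/-- All the phases are valid, the first one for the array `a`. -/
def PhasesValid (len : ℕ → ℕ) (content : ℕ → ℕ → ℤ) (B M : ℕ) : ℕ → List Phase → Prop
  | _, [] => True
  | a, ph :: l => ph.Valid len content B M a ∧ PhasesValid len content B M (a + 1) l

theorem abs_sum_range_le {t : ℕ → ℤ} {T l : ℕ} (h : ∀ j < l, |t j| ≤ T) :
    |∑ j ∈ Finset.range l, t j| ≤ ((l * T : ℕ) : ℤ) := by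
  refine (Finset.abs_sum_le_sum_abs _ _).trans ?_
  refine (Finset.sum_le_card_nsmul _ _ _ fun j hj => h j (Finset.mem_range.1 hj)).trans ?_
  simp

theorem exec_runPhases (phs : List Phase) : ∃ C : ℕ, ∀ (len : ℕ → ℕ) (content : ℕ → ℕ → ℤ)
    (a B K M : ℕ), (∀ z : ℤ, |z| ≤ B → bitLength z ≤ K) →
    (∀ b, ∀ j < len b, |content b j| ≤ B) → M ≤ B → PhasesValid len content B M a phs →
    ∀ reg, RegLe B reg → ∃ reg' c, Exec (runPhases a phs) ⟨reg, filled len content a 0⟩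
      ⟨reg', filled len content (a + phs.length) 0⟩ c ∧ RegLe B reg' ∧
      c ≤ C * (M + 1) ^ 2 * K := by
  induction phs with
  | nil =>
    refine ⟨1, fun len content a B K M hBK _ _ _ reg hreg => ⟨reg, 1, .skip _, hreg, ?_⟩⟩
    have hK : 1 ≤ K := (one_le_bitLength 0).trans (hBK 0 (by simp))
    rw [one_mul]
    exact Nat.mul_pos (by positivity) hK
  | cons ph phs ih =>
    obtain ⟨C1, hC1⟩ := exec_sumFill ph.bound ph.sumBound ph.summand ph.value
    obtain ⟨C2, hC2⟩ := ih
    refine ⟨C1 + C2, fun len content a B K M hBK hcont hMB hv reg hreg => ?_⟩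
    obtain ⟨⟨Lv, ev, h1, h2, h3, h4, h5, h6, h7⟩, hv'⟩ := hv
    -- `exec_sumFill` wants bounded contents for every `i`; truncating at `len a` keeps all filled
    -- cells inside the range where `content` is bounded.
    set A : ℕ → ℕ → ℤ → ℤ := fun i => filled len content a (min i (len a)) with hA
    have hAi : ∀ i ≤ len a, A i = filled len content a i := fun i hi => by
      simp only [hA, min_eq_left hi]
    obtain ⟨reg1, c1, hc1, hr1, hc1'⟩ := hC1 a B K M A (len a) Lv ev (content a) hBK
      (by
        intro i b j
        simp only [hA, filled]
        split_ifs with h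
        · refine hcont _ _ ?_
          rcases h.2 with h | ⟨rfl, h⟩
          · exact h.2
          · exact h.trans_le (min_le_right _ _)
        · simp)
      hMB h1 h2 (fun i hi => by rw [hAi i hi.le, hAi (i + 1) hi, filled_succ])
      (fun reg i hi => by rw [hAi i hi]; exact h3 reg i hi)
      (fun reg i hi h => by rw [hAi i hi.le]; exact h4 reg i hi h)
      (fun reg i l hi hl h h' => by rw [hAi i hi.le]; exact h5 reg i l hi hl h h')
      (fun reg i hi h h' => by rw [hAi i hi.le]; exact h6 reg i hi h h')
      (by
        intro i hi l hl
        obtain ⟨T, hT, hT'⟩ := h7 i hi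
        refine (abs_sum_range_le fun j hj => hT j (hj.trans_le hl)).trans ?_
        exact_mod_cast (Nat.mul_le_mul_right T hl).trans hT')
      reg hreg
    rw [hAi 0 (Nat.zero_le _), hAi _ le_rfl, filled_len] at hc1
    obtain ⟨reg2, c2, hc2, hr2, hc2'⟩ := hC2 len content (a + 1) B K M hBK hcont hMB hv' reg1 hr1
    refine ⟨reg2, c1 + c2, .seq hc1 ?_, hr2, ?_⟩
    · rw [List.length_cons, show a + (phs.length + 1) = a + 1 + phs.length by ring]
      exact hc2
    · rw [add_mul, add_mul]
      exact add_le_add hc1' hc2'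

/-- The indicator of the equality of two values. -/
def Expr.eq (e f : Expr) : Expr :=
  .div (.const 1) (.add (.const 1) (.mul (.sub e f) (.sub e f)))

/-- The quotient `1 / (1 + d ^ 2)` rounds down to 0 unless `d = 0`. Such indicators replace
conditionals in the program. -/
theorem Expr.eval_eq (s : Store) (e f : Expr) :
    (e.eq f).eval s = if e.eval s = f.eval s then 1 else 0 := by
  simp only [Expr.eq, Expr.eval]
  split_ifs with h
  · simp [h]
  · have h1 : e.eval s - f.eval s ≠ 0 := sub_ne_zero.2 h
    have h2 := mul_self_pos.2 h1
    exact Int.ediv_eq_zero_of_lt (by norm_num) (by linarith)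

/-- The indicator of a nonzero value. -/
def Expr.nonzero (e : Expr) : Expr := .div e e

theorem Expr.eval_nonzero (s : Store) (e : Expr) :
    e.nonzero.eval s = if e.eval s = 0 then 0 else 1 := by
  simp only [Expr.nonzero, Expr.eval]
  split_ifs with h
  · simp [h]
  · exact Int.ediv_self h

end Phases

/-! ### Size bounds for degrees and weights -/

namespace Instance

section Bounds

variable {V : Type*} [Fintype V] [DecidableEq V] (I : Instance V)

/-- The start node and the nodes without free edges get the flag `0`, the other nodes `1`. -/
def exitFlag (v : V) : ℕ := if v = I.start ∨ I.freeDegree v = 0 then 0 else 1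

theorem sum_sum_mult_add_card_eq_size :
    Fintype.card V + ∑ v, ∑ w, I.graph.mult (v, w) = I.size := by
  rw [size, ← Fintype.sum_prod_type' (f := fun v w => I.graph.mult (v, w)),
    DirectedMultigraph.edges, Finset.sum_filter]
  congr 1
  refine Finset.sum_congr rfl fun e _ => ?_
  split_ifs with h
  · rfl
  · change I.graph.mult e = 0
    omega

theorem freeMult_le (v w : V) : I.freeMult v w ≤ I.graph.mult (v, w) := by
  rw [freeMult, residual_mult]
  split_ifs
  · exact le_rfl
  · exact Nat.zero_le _
  · exact le_rfl

theorem residual_mult_le (e : V × V) : I.residual.mult e ≤ I.graph.mult e := by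
  rw [residual_mult]
  split_ifs
  · exact Nat.zero_le _
  · exact le_rfl

theorem card_le_size : Fintype.card V ≤ I.size := by
  rw [← sum_sum_mult_add_card_eq_size]
  exact Nat.le_add_right _ _

theorem one_le_card (I : Instance V) : 1 ≤ Fintype.card V := Fintype.card_pos_iff.2 ⟨I.start⟩

theorem sum_freeDegree_le_size : ∑ v, I.freeDegree v ≤ I.size := by
  rw [← sum_sum_mult_add_card_eq_size]
  exact (Finset.sum_le_sum fun v _ => Finset.sum_le_sum fun w _ => I.freeMult_le v w).trans
    (Nat.le_add_left _ _)

theorem freeDegree_le_size (v : V) : I.freeDegree v ≤ I.size :=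
  (Finset.single_le_sum (f := I.freeDegree) (fun _ _ => Nat.zero_le _)
    (Finset.mem_univ v)).trans I.sum_freeDegree_le_size

theorem sum_mult_le_size (v : V) : ∑ w, I.graph.mult (v, w) ≤ I.size := by
  rw [← sum_sum_mult_add_card_eq_size]
  exact (Finset.single_le_sum (f := fun v => ∑ w, I.graph.mult (v, w))
    (fun _ _ => Nat.zero_le _) (Finset.mem_univ v)).trans (Nat.le_add_left _ _)

theorem mult_le_size (v w : V) : I.graph.mult (v, w) ≤ I.size :=
  (Finset.single_le_sum (f := fun w => I.graph.mult (v, w))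
    (fun _ _ => Nat.zero_le _) (Finset.mem_univ w)).trans (I.sum_mult_le_size v)

theorem exitWeight_le_size (v w : V) : I.exitWeight v w ≤ I.size := by
  have h1 := I.one_le_card.trans I.card_le_size
  rw [exitWeight]
  split_ifs
  · exact h1
  · omega
  · exact (I.freeMult_le v w).trans (I.mult_le_size v w)

/-- Resolves the case distinction into arithmetic that an `Expr` can evaluate. -/
theorem exitWeight_eq (v w : V) : (I.exitWeight v w : ℤ) = I.exitFlag v * I.freeMult v w +
    (1 - I.exitFlag v) * if w = I.start then 1 else 0 := by
  rw [exitWeight, exitFlag]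
  split_ifs <;> simp

theorem sum_exitWeight (v : V) : ((∑ w, I.exitWeight v w : ℕ) : ℤ) =
    I.exitFlag v * I.freeDegree v + (1 - I.exitFlag v) := by
  push_cast
  simp only [exitWeight_eq, Finset.sum_add_distrib, ← Finset.mul_sum, Finset.sum_ite_eq',
    Finset.mem_univ, if_true, mul_one, freeDegree]
  push_cast
  rfl

theorem sum_exitWeight_le_size (v : V) : ∑ w, I.exitWeight v w ≤ I.size := by
  have h1 := I.one_le_card.trans I.card_le_size
  have h2 := I.freeDegree_le_size v
  have h := I.sum_exitWeight v
  rw [exitFlag] at h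
  split_ifs at h <;> simp only [Nat.cast_zero, Nat.cast_one] at h <;> omega

theorem abs_exitLaplacian_le (v w : V) : |I.exitLaplacian v w| ≤ ((2 * I.size : ℕ) : ℤ) := by
  have h1 := I.sum_exitWeight_le_size v
  have h2 := I.exitWeight_le_size v w
  rw [exitLaplacian, Matrix.of_apply, abs_le]
  generalize ∑ w, I.exitWeight v w = x at *
  split_ifs <;> constructor <;> omega

end Bounds

end Instance

/-! ### Bounds for matrix powers, traces and coefficients -/

section MatrixBounds

variable {V : Type*} [Fintype V] [DecidableEq V]

theorem abs_pow_apply_le {X : Matrix V V ℤ} {T : ℕ} (hX : ∀ v w, |X v w| ≤ T) (k : ℕ) (v w : V) :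
    |(X ^ k) v w| ≤ (((Fintype.card V * T) ^ k : ℕ) : ℤ) := by
  induction k generalizing w with
  | zero =>
    rw [pow_zero, pow_zero, Matrix.one_apply]
    split_ifs <;> simp
  | succ k ih =>
    rw [pow_succ, Matrix.mul_apply]
    refine (Finset.abs_sum_le_sum_abs _ _).trans ?_
    refine (Finset.sum_le_card_nsmul _ _ ((((Fintype.card V * T) ^ k * T : ℕ) : ℤ))
      fun j _ => ?_).trans_eq ?_
    · rw [abs_mul, Nat.cast_mul]
      exact mul_le_mul (ih j) (hX j w) (abs_nonneg _) (by positivity)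
    · rw [Finset.card_univ, nsmul_eq_mul]
      push_cast
      ring

theorem abs_trace_pow_le {X : Matrix V V ℤ} {T : ℕ} (hX : ∀ v w, |X v w| ≤ T) (k : ℕ) :
    |(X ^ k).trace| ≤ ((Fintype.card V * (Fintype.card V * T) ^ k : ℕ) : ℤ) := by
  refine (Finset.abs_sum_le_sum_abs _ _).trans ?_
  refine (Finset.sum_le_card_nsmul _ _ _ fun j _ => abs_pow_apply_le hX k j j).trans_eq ?_
  rw [Finset.card_univ, nsmul_eq_mul]
  push_cast
  ring

/-- Newton's identity has `k + 1` summands, each at most `Q ^ (k + 1)` by induction, and the factor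
`k + 1` on its left-hand side cancels their number. -/
theorem abs_coeff_charpoly_le {X : Matrix V V ℤ} {Q : ℕ}
    (hX : ∀ k, |(X ^ (k + 1)).trace| ≤ ((Q ^ (k + 1) : ℕ) : ℤ)) (k : ℕ)
    (hk : k ≤ Fintype.card V) :
    |X.charpoly.coeff (Fintype.card V - k)| ≤ ((Q ^ k : ℕ) : ℤ) := by
  induction k using Nat.strong_induction_on with
  | _ k ih =>
    cases k with
    | zero =>
      have h := X.charpoly_monic.coeff_natDegree
      rw [Matrix.charpoly_natDegree_eq_dim] at h
      simp [h]
    | succ k =>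
      have h := newton_charpoly X k hk
      have h2 := congrArg abs h
      rw [abs_mul, abs_neg] at h2
      have h3 := abs_sum_range_le (l := k + 1) (T := Q ^ (k + 1))
        (t := fun i => X.charpoly.coeff (Fintype.card V - (k - i)) * (X ^ (i + 1)).trace) (by
          intro i hi
          rw [abs_mul]
          calc _ ≤ ((Q ^ (k - i) : ℕ) : ℤ) * ((Q ^ (i + 1) : ℕ) : ℤ) :=
                mul_le_mul (ih _ (by omega) (by omega)) (hX i) (abs_nonneg _) (by positivity)
            _ = _ := by
              rw [← Nat.cast_mul, ← pow_add]
              congr 2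
              omega)
      rw [← h2, abs_of_nonneg (by positivity), Nat.cast_mul] at h3
      exact le_of_mul_le_mul_left h3 (by positivity)

end MatrixBounds

/-! ### Contents of the tables and bounds for them -/

namespace Instance

section Contents

variable {n : ℕ} (I : Instance (Fin n))

/-- The node with the number `v`, if there is one. -/
def node (v : ℕ) : Fin n := if h : v < n then ⟨v, h⟩ else I.start

@[simp] theorem node_val (v : Fin n) : I.node v = v := by simp [node]

theorem val_node {v : ℕ} (h : v < n) : (I.node v : ℕ) = v := by simp [node, h]

theorem sum_range_node {R : Type*} [AddCommMonoid R] (g : Fin n → R) :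
    ∑ v ∈ Finset.range n, g (I.node v) = ∑ v, g v := by
  rw [Finset.sum_range]
  simp

theorem prod_range_node {R : Type*} [CommMonoid R] (g : Fin n → R) :
    ∏ v ∈ Finset.range n, g (I.node v) = ∏ v, g v := by
  rw [Finset.prod_range]
  simp

theorem prod_range_node_node {R : Type*} [CommMonoid R] (g : Fin n → Fin n → R) :
    ∏ q ∈ Finset.range (n * n), g (I.node (q / n)) (I.node (q % n)) = ∏ v, ∏ w, g v w := by
  rw [Finset.prod_range, ← Fintype.prod_prod_type' (f := g), ← finProdFinEquiv.symm.prod_comp]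
  refine Fintype.prod_congr _ _ fun q => ?_
  rw [← node_val I (finProdFinEquiv.symm q).1, ← node_val I (finProdFinEquiv.symm q).2]
  rfl

/-- The excess of the out-degree over the in-degree. -/
def excess (v : Fin n) : ℤ := ∑ w, ((I.graph.mult (v, w) : ℤ) - I.graph.mult (w, v))

/-- The lengths of the arrays that the counting program fills. -/
def arrayLength : ℕ → ℕ
  | 0 => 2 + n * n + n * n
  | 1 => n
  | 2 => 1
  | 3 => n
  | 4 => n * n
  | 5 => n
  | 6 => n
  | 7 => n * n
  | 8 => (n + 1) * (n * n)
  | 9 => n + 1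
  | 10 => n + 1
  | 11 => 1
  | 12 => ∑ v, I.freeDegree v + 1
  | 13 => n + 1
  | 14 => n * n + 1
  | _ => 0

/-- The contents of the arrays that the counting program fills. -/
noncomputable def arrayContent : ℕ → ℕ → ℤ
  | 0, j => I.encode.getD j 0
  | 1, j => I.excess (I.node j)
  | 2, _ => ∑ v, I.excess v * I.excess v
  | 3, j => I.residual.outDegree (I.node j)
  | 4, j => I.freeMult (I.node (j / n)) (I.node (j % n))
  | 5, j => I.freeDegree (I.node j)
  | 6, j => I.exitFlag (I.node j)
  | 7, j => (-I.exitLaplacian) (I.node (j / n)) (I.node (j % n))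
  | 8, j => ((-I.exitLaplacian) ^ (j / (n * n))) (I.node (j / n % n)) (I.node (j % n))
  | 9, j => ((-I.exitLaplacian) ^ j).trace
  | 10, j => (-I.exitLaplacian).charpoly.coeff (n - j)
  | 11, _ => ∑ v, (I.freeDegree v : ℤ)
  | 12, j => j.factorial
  | 13, j => ∏ v ∈ Finset.range j,
      ((I.freeDegree (I.node v) - I.exitFlag (I.node v)).factorial : ℤ)
  | 14, j => ∏ q ∈ Finset.range j,
      ((I.freeMult (I.node (q / n)) (I.node (q % n))).factorial : ℤ)
  | _, _ => 0

theorem length_encode : I.encode.length = 2 + n * n + n * n := by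
  simp [encode]
  omega

theorem encode_getD_zero : I.encode.getD 0 0 = n := rfl

theorem encode_getD_one : I.encode.getD 1 0 = ((I.start : ℕ) : ℤ) := rfl

theorem index_lt {v w : ℕ} (hv : v < n) (hw : w < n) : v * n + w < n * n := by
  calc v * n + w < v * n + n := by omega
    _ = (v + 1) * n := by ring
    _ ≤ n * n := Nat.mul_le_mul_right _ hv

theorem finProdFinEquiv_symm_index {v w : ℕ} (hv : v < n) (hw : w < n) :
    finProdFinEquiv.symm (⟨v * n + w, index_lt hv hw⟩ : Fin (n * n)) =
      (I.node v, I.node w) := by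
  rw [Equiv.symm_apply_eq]
  ext
  simp only [finProdFinEquiv_apply_val, I.val_node hv, I.val_node hw]
  ring

theorem encode_getD_mult {v w : ℕ} (hv : v < n) (hw : w < n) :
    I.encode.getD (2 + v * n + w) 0 = I.graph.mult (I.node v, I.node w) := by
  have h := index_lt hv hw
  rw [encode, List.append_assoc, List.getD_eq_getElem?_getD,
    List.getElem?_append_right (by simp; omega),
    List.getElem?_append_left (by simp; omega)]
  simp only [List.length_cons, List.length_nil, List.getElem?_ofFn,
    show 2 + v * n + w - (0 + 1 + 1) = v * n + w by omega, h, dif_pos, Option.getD_some]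
  rw [I.finProdFinEquiv_symm_index hv hw]

theorem encode_getD_priority {v w : ℕ} (hv : v < n) (hw : w < n) :
    I.encode.getD (2 + n * n + v * n + w) 0 =
      if (I.node v, I.node w) ∈ I.priority then 1 else 0 := by
  have h := index_lt hv hw
  rw [encode, List.getD_eq_getElem?_getD,
    List.getElem?_append_right (by simp; omega)]
  simp only [List.length_cons, List.length_nil, List.length_append, List.length_ofFn,
    List.getElem?_ofFn,
    show 2 + n * n + v * n + w - (0 + 1 + 1 + n * n) = v * n + w by omega, h, dif_pos,
    Option.getD_some]
  rw [I.finProdFinEquiv_symm_index hv hw]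

theorem abs_encode_getD_le (j : ℕ) : |I.encode.getD j 0| ≤ (I.size : ℤ) := by
  have h1 := I.one_le_card.trans I.card_le_size
  have h2 := I.card_le_size
  rw [Fintype.card_fin] at h2
  have key : ∀ z ∈ I.encode, |z| ≤ (I.size : ℤ) := by
    intro z hz
    simp only [encode, List.mem_append, List.mem_cons, List.not_mem_nil, or_false,
      List.mem_ofFn] at hz
    rcases hz with (((rfl | rfl) | ⟨i, rfl⟩) | ⟨i, rfl⟩)
    · rw [Nat.abs_cast]
      exact_mod_cast h2
    · rw [Nat.abs_cast]
      exact_mod_cast I.start.2.le.trans h2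
    · rw [Nat.abs_cast]
      exact_mod_cast I.mult_le_size _ _
    · split_ifs
      · rw [abs_one]
        exact_mod_cast h1
      · simp
  by_cases hj : j < I.encode.length
  · rw [List.getD_eq_getElem _ _ hj]
    exact key _ (List.getElem_mem hj)
  · rw [List.getD_eq_default _ _ (by omega)]
    simp

theorem abs_excess_summand_le (v w : Fin n) :
    |(I.graph.mult (v, w) : ℤ) - I.graph.mult (w, v)| ≤ (I.size : ℤ) := by
  have h1 := I.mult_le_size v w
  have h2 := I.mult_le_size w v
  rw [abs_le]
  constructor <;> omega

theorem abs_excess_le (v : Fin n) : |I.excess v| ≤ ((n * I.size : ℕ) : ℤ) := by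
  rw [excess, ← I.sum_range_node]
  exact abs_sum_range_le fun j _ => I.abs_excess_summand_le _ _

/-- A sum of squares lets one number test the balance at all nodes. -/
theorem excess_sq_eq_zero_iff : ∑ v, I.excess v * I.excess v = 0 ↔ I.graph.Balanced := by
  rw [Finset.sum_eq_zero_iff_of_nonneg fun v _ => mul_self_nonneg _]
  simp only [Finset.mem_univ, forall_const, mul_self_eq_zero, excess, Finset.sum_sub_distrib,
    sub_eq_zero]
  refine forall_congr' fun v => ?_
  rw [DirectedMultigraph.outDegree_eq_sum, DirectedMultigraph.inDegree_eq_sum, eq_comm]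
  exact_mod_cast Iff.rfl

/-- A bound for the numbers of iterations. -/
def iterationBound : ℕ := 2 * I.size ^ 3

/-- A bound for the absolute values of the numbers that occur. -/
def valueBound : ℕ := I.iterationBound ^ (I.size ^ 3 + 3)

/-- A bound for the bit lengths of the numbers that occur. -/
def lengthBound : ℕ := I.iterationBound * (I.size ^ 3 + 3) + 1

theorem one_le_size : 1 ≤ I.size := I.one_le_card.trans I.card_le_size

theorem le_size : n ≤ I.size := by simpa using I.card_le_size

theorem one_le_n (I : Instance (Fin n)) : 1 ≤ n := by simpa using I.one_le_card

theorem pos_iterationBound : 0 < I.iterationBound := by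
  have := I.one_le_size
  rw [iterationBound]
  positivity

theorem le_valueBound {x e : ℕ} (hx : x ≤ I.iterationBound ^ e) (he : e ≤ I.size ^ 3 + 3) :
    x ≤ I.valueBound :=
  hx.trans (Nat.pow_le_pow_right I.pos_iterationBound he)

theorem le_valueBound_of_le {x : ℕ} (hx : x ≤ I.iterationBound) : x ≤ I.valueBound :=
  I.le_valueBound (e := 1) (by simpa using hx) (by omega)

theorem size_pow_le {k : ℕ} (hk : k ≤ 3) : 2 * I.size ^ k ≤ I.iterationBound :=
  Nat.mul_le_mul_left _ (Nat.pow_le_pow_right I.one_le_size hk)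

theorem bitLength_le_lengthBound {z : ℤ} (hz : |z| ≤ (I.valueBound : ℤ)) :
    bitLength z ≤ I.lengthBound := by
  rw [lengthBound, bitLength_le_iff]
  rw [Int.abs_eq_natAbs] at hz
  have h : z.natAbs ≤ I.valueBound := by exact_mod_cast hz
  refine h.trans_lt ?_
  rw [valueBound, pow_mul]
  -- From `x < 2 ^ x` for `x = I.iterationBound`.
  exact Nat.pow_lt_pow_left Nat.lt_two_pow_self (by omega)

theorem abs_neg_exitLaplacian_le (v w : Fin n) :
    |(-I.exitLaplacian) v w| ≤ ((2 * I.size : ℕ) : ℤ) := by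
  rw [Matrix.neg_apply, abs_neg]
  exact I.abs_exitLaplacian_le v w

theorem pow_card_mul_le (k : ℕ) : (n * (2 * I.size)) ^ k ≤ I.iterationBound ^ k := by
  refine Nat.pow_le_pow_left ?_ k
  calc n * (2 * I.size) ≤ I.size * (2 * I.size) := Nat.mul_le_mul_right _ I.le_size
    _ = 2 * I.size ^ 2 := by ring
    _ ≤ _ := I.size_pow_le (by norm_num)

theorem abs_powers_le (k : ℕ) (v w : Fin n) :
    |((-I.exitLaplacian) ^ k) v w| ≤ ((I.iterationBound ^ k : ℕ) : ℤ) := by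
  refine (abs_pow_apply_le I.abs_neg_exitLaplacian_le k v w).trans ?_
  rw [Fintype.card_fin]
  exact_mod_cast I.pow_card_mul_le k

theorem abs_traces_le (k : ℕ) :
    |((-I.exitLaplacian) ^ k).trace| ≤ ((n * I.iterationBound ^ k : ℕ) : ℤ) := by
  refine (abs_trace_pow_le I.abs_neg_exitLaplacian_le k).trans ?_
  rw [Fintype.card_fin]
  exact_mod_cast Nat.mul_le_mul_left _ (I.pow_card_mul_le k)

/-- `abs_coeff_charpoly_le` needs a pure power. The factor `n` from the trace is absorbed through `n
≤ n ^ (k + 1)`, at the price of a third factor of the size in `iterationBound`. -/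
theorem abs_traces_succ_le (k : ℕ) :
    |((-I.exitLaplacian) ^ (k + 1)).trace| ≤ ((I.iterationBound ^ (k + 1) : ℕ) : ℤ) := by
  refine (abs_trace_pow_le I.abs_neg_exitLaplacian_le (k + 1)).trans ?_
  rw [Fintype.card_fin]
  have h1 : n ≤ n ^ (k + 1) := Nat.le_self_pow (by omega) n
  have h2 : n * (n * (2 * I.size)) ≤ I.iterationBound := by
    have := I.le_size
    calc n * (n * (2 * I.size)) ≤ I.size * (I.size * (2 * I.size)) := by gcongr
      _ = 2 * I.size ^ 3 := by ring
  have h3 : n * (n * (2 * I.size)) ^ (k + 1) ≤ I.iterationBound ^ (k + 1) := by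
    calc n * (n * (2 * I.size)) ^ (k + 1) ≤ n ^ (k + 1) * (n * (2 * I.size)) ^ (k + 1) := by
          gcongr
      _ = (n * (n * (2 * I.size))) ^ (k + 1) := (mul_pow _ _ _).symm
      _ ≤ _ := Nat.pow_le_pow_left h2 _
  exact_mod_cast h3

theorem abs_coeffs_le {k : ℕ} (hk : k ≤ n) :
    |(-I.exitLaplacian).charpoly.coeff (n - k)| ≤ ((I.iterationBound ^ k : ℕ) : ℤ) := by
  have := abs_coeff_charpoly_le I.abs_traces_succ_le k (by simpa using hk)
  rwa [Fintype.card_fin] at this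

theorem factorial_le {k : ℕ} (hk : k ≤ I.size) : k.factorial ≤ I.iterationBound ^ I.size :=
  calc k.factorial ≤ I.size.factorial := Nat.factorial_le hk
    _ ≤ I.size ^ I.size := Nat.factorial_le_pow _
    _ ≤ _ := Nat.pow_le_pow_left (by
      have := I.size_pow_le (k := 1) (by norm_num)
      rw [pow_one] at this
      omega) _

theorem prod_factorial_le {c : ℕ → ℕ} (hc : ∀ i, c i ≤ I.size) (k : ℕ) :
    |∏ i ∈ Finset.range k, ((c i).factorial : ℤ)| ≤
      ((I.iterationBound ^ (I.size * k) : ℕ) : ℤ) := by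
  rw [← Nat.cast_prod, Nat.abs_cast, pow_mul]
  have := Finset.prod_le_pow_card (Finset.range k) (fun i => (c i).factorial) _
    fun i _ => I.factorial_le (hc i)
  rw [Finset.card_range] at this
  exact_mod_cast this

theorem size_le_iterationBound : I.size ≤ I.iterationBound := by
  have := I.size_pow_le (k := 1) (by norm_num)
  rw [pow_one] at this
  omega

/-- The extreme case is array 14: up to `n * n` factorials, each at most `iterationBound ^ size`,
which accounts for the exponent `size ^ 3`. -/
theorem arrayContent_le (b j : ℕ) (hj : j < I.arrayLength b) :
    |I.arrayContent b j| ≤ (I.valueBound : ℤ) := by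
  have hn := I.le_size
  have h1 := I.one_le_size
  have hS := I.size_le_iterationBound
  have hSS : n * I.size ≤ I.iterationBound := by
    have := I.size_pow_le (k := 2) (by norm_num)
    nlinarith
  have hS3 : I.size ≤ I.size ^ 3 := Nat.le_self_pow (by norm_num) _
  have hof : ∀ {z : ℤ} {x e : ℕ}, |z| ≤ x → x ≤ I.iterationBound ^ e → e ≤ I.size ^ 3 + 3 →
      |z| ≤ (I.valueBound : ℤ) := fun hz hx he =>
    hz.trans (by exact_mod_cast I.le_valueBound hx he)
  have hof1 : ∀ {z : ℤ} {x : ℕ}, |z| ≤ x → x ≤ I.iterationBound →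
      |z| ≤ (I.valueBound : ℤ) := fun hz hx =>
    hz.trans (by exact_mod_cast I.le_valueBound_of_le hx)
  have hcast : ∀ {x : ℕ}, x ≤ I.size → |(x : ℤ)| ≤ (I.valueBound : ℤ) := fun hx =>
    hof1 (x := I.size) (by rw [Nat.abs_cast]; exact_mod_cast hx) hS
  match b with
  | 0 => exact hof1 (I.abs_encode_getD_le j) hS
  | 1 => exact hof1 (I.abs_excess_le _) hSS
  | 2 =>
    refine hof (x := n * (n * I.size * (n * I.size))) (e := 3) ?_ ?_ (by omega)
    · rw [arrayContent, ← I.sum_range_node (fun v => I.excess v * I.excess v)]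
      refine abs_sum_range_le fun v _ => ?_
      rw [abs_mul, Nat.cast_mul]
      exact mul_le_mul (I.abs_excess_le _) (I.abs_excess_le _) (abs_nonneg _) (by positivity)
    · calc n * (n * I.size * (n * I.size)) ≤
            I.iterationBound * (I.iterationBound * I.iterationBound) := by
            gcongr
            exact hn.trans hS
        _ = _ := by ring
  | 3 =>
    refine hcast ?_
    rw [DirectedMultigraph.outDegree_eq_sum]
    exact (Finset.sum_le_sum fun w _ => I.residual_mult_le _).trans (I.sum_mult_le_size _)
  | 4 => exact hcast ((I.freeMult_le _ _).trans (I.mult_le_size _ _))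
  | 5 => exact hcast (I.freeDegree_le_size _)
  | 6 =>
    refine hcast ?_
    rw [exitFlag]
    split_ifs <;> omega
  | 7 => exact hof1 (I.abs_neg_exitLaplacian_le _ _) (by simpa using I.size_pow_le (k := 1))
  | 8 =>
    refine hof (I.abs_powers_le _ _ _) le_rfl ?_
    have : j / (n * n) < n + 1 := Nat.div_lt_of_lt_mul (by rw [mul_comm]; exact hj)
    omega
  | 9 =>
    refine hof (I.abs_traces_le j) (e := j + 1) ?_ ?_
    · rw [pow_succ']
      exact Nat.mul_le_mul_right _ (hn.trans hS)
    · have : j < n + 1 := hj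
      omega
  | 10 =>
    have : j < n + 1 := hj
    exact hof (I.abs_coeffs_le (by omega)) le_rfl (by omega)
  | 11 =>
    have h := hcast I.sum_freeDegree_le_size
    push_cast at h
    exact h
  | 12 =>
    have h2 : j < ∑ v, I.freeDegree v + 1 := hj
    have h3 := I.sum_freeDegree_le_size
    refine hof (x := j.factorial) (by simp [arrayContent]) (I.factorial_le (by omega)) (by omega)
  | 13 =>
    have h2 : j < n + 1 := hj
    refine hof (I.prod_factorial_le (c := fun v => I.freeDegree (I.node v) -
      I.exitFlag (I.node v)) (fun v => (Nat.sub_le _ _).trans (I.freeDegree_le_size _)) j)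
      le_rfl ?_
    have h3 : j ≤ I.size := by omega
    nlinarith [Nat.mul_le_mul_left I.size h3, Nat.pow_le_pow_right h1 (show 2 ≤ 3 by norm_num)]
  | 14 =>
    have h2 : j < n * n + 1 := hj
    refine hof (I.prod_factorial_le (c := fun q => I.freeMult (I.node (q / n)) (I.node (q % n)))
      (fun v => (I.freeMult_le _ _).trans (I.mult_le_size _ _)) j) le_rfl ?_
    have h3 : j ≤ I.size * I.size := by nlinarith
    nlinarith [Nat.mul_le_mul_left I.size h3]
  | _ + 15 => simp [arrayContent]

end Contents

end Instance

/-! ### The counting program -/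

theorem Expr.eval_add (s : Store) (e f : Expr) : (add e f).eval s = e.eval s + f.eval s := rfl

theorem Expr.eval_sub (s : Store) (e f : Expr) : (sub e f).eval s = e.eval s - f.eval s := rfl

theorem Expr.eval_mul (s : Store) (e f : Expr) : (mul e f).eval s = e.eval s * f.eval s := rfl

theorem Expr.eval_div (s : Store) (e f : Expr) : (div e f).eval s = e.eval s / f.eval s := rfl

theorem Expr.eval_const (s : Store) (z : ℤ) : (const z).eval s = z := rfl

namespace CountProgram

open ECP.Expr

def nE : Expr := load 0 (const 0)

def startE : Expr := load 0 (const 1)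

/-- The offset 2 skips the number of nodes and the start node. -/
def multE (v w : Expr) : Expr := load 0 (add (add (const 2) (mul v nE)) w)

def priorityE (v w : Expr) : Expr :=
  load 0 (add (add (add (const 2) (mul nE nE)) (mul v nE)) w)

/-- Register 1 holds the index of the cell being filled. In an `n × n` table this index is `row * n
+ col`. -/
def rowE : Expr := div (reg 1) nE

def colE : Expr := sub (reg 1) (mul nE rowE)

def prevE : Expr := sub (reg 1) (const 1)

def flagE : Expr := load 6 rowE

def powE : Expr := div (reg 1) (mul nE nE)

/-- The phase that assigns `value` without a sum. -/
def plain (bound value : Expr) : Phase := ⟨bound, const 0, const 0, value⟩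

/-- The phase that assigns the sum of `summand` over all nodes. -/
def nodeSum (bound summand : Expr) : Phase := ⟨bound, nE, summand, reg 3⟩

def excessPhase : Phase :=
  nodeSum nE (sub (multE (reg 1) (reg 2)) (multE (reg 2) (reg 1)))

def imbalancePhase : Phase := nodeSum (const 1) (mul (load 1 (reg 2)) (load 1 (reg 2)))

def residualDegreePhase : Phase :=
  nodeSum nE (mul (multE (reg 1) (reg 2)) (sub (const 1) (priorityE (reg 1) (reg 2))))

/-- A priority edge is dropped only if its tail has residual edges, which array 3 tells. -/
def freeMultPhase : Phase :=
  plain (mul nE nE) (mul (multE rowE colE)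
    (sub (const 1) (mul (priorityE rowE colE) (nonzero (load 3 rowE)))))

def freeDegreePhase : Phase := nodeSum nE (load 4 (add (mul (reg 1) nE) (reg 2)))

def flagPhase : Phase :=
  plain nE (mul (sub (const 1) (Expr.eq (reg 1) startE)) (nonzero (load 5 (reg 1))))

/-- Computes the negated matrix, since the constant coefficient of the characteristic polynomial of
`-L` is `det L`. -/
def laplacianPhase : Phase :=
  plain (mul nE nE) (sub
    (mul (sub (const 1) (Expr.eq rowE startE))
      (add (mul flagE (load 4 (reg 1))) (mul (sub (const 1) flagE) (Expr.eq colE startE))))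
    (mul (Expr.eq rowE colE) (add (mul flagE (load 5 rowE)) (sub (const 1) flagE))))

/-- Cell `k * n² + v * n + w` holds entry `(v, w)` of the `k`-th power, so `rowE` is `k * n + v`
here and the summand reads block `k - 1` of the same array. For `k = 0` the sum is empty and `value`
adds the identity matrix. -/
def powersPhase : Phase where
  bound := mul (add nE (const 1)) (mul nE nE)
  sumBound := mul nE (sub (const 1) (Expr.eq powE (const 0)))
  summand := mul (load 8 (add (sub (mul rowE nE) (mul nE nE)) (reg 2)))
    (load 7 (add (mul (reg 2) nE) colE))
  value := add (reg 3) (mul (Expr.eq powE (const 0)) (Expr.eq rowE colE))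

def tracesPhase : Phase :=
  nodeSum (add nE (const 1))
    (load 8 (add (add (mul (reg 1) (mul nE nE)) (mul (reg 2) nE)) (reg 2)))

/-- Newton's identities: cell `i` is the coefficient of degree `n - i`. For `i = 0` the quotient is
`0 / 0 = 0`, and the indicator supplies the leading coefficient 1. -/
def coeffsPhase : Phase where
  bound := add nE (const 1)
  sumBound := reg 1
  summand := mul (load 10 (sub prevE (reg 2))) (load 9 (add (reg 2) (const 1)))
  value := add (Expr.eq (reg 1) (const 0)) (div (sub (const 0) (reg 3)) (reg 1))

def totalPhase : Phase := nodeSum (const 1) (load 5 (reg 2))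

def factorialPhase : Phase :=
  plain (add (load 11 (const 0)) (const 1))
    (add (Expr.eq (reg 1) (const 0)) (mul (reg 1) (load 12 prevE)))

def numeratorPhase : Phase :=
  plain (add nE (const 1)) (add (Expr.eq (reg 1) (const 0))
    (mul (load 13 prevE) (load 12 (sub (load 5 prevE) (load 6 prevE)))))

def denominatorPhase : Phase :=
  plain (add (mul nE nE) (const 1)) (add (Expr.eq (reg 1) (const 0))
    (mul (load 14 prevE) (load 12 (load 4 prevE))))

def phases : List Phase :=
  [excessPhase, imbalancePhase, residualDegreePhase, freeMultPhase, freeDegreePhase, flagPhase,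
    laplacianPhase, powersPhase, tracesPhase, coeffsPhase, totalPhase, factorialPhase,
    numeratorPhase, denominatorPhase]

/-- The first factor annihilates unbalanced instances, for which the quotient has no meaning. The
cells read are the final ones of their tables. -/
def resultE : Expr :=
  mul (sub (const 1) (nonzero (load 2 (const 0))))
    (div (mul (load 13 nE) (load 10 nE)) (load 14 (mul nE nE)))

/-- The program that counts the solutions. -/
def program : Program := .seq (runPhases 1 phases) (.assign 0 resultE)

end CountProgram

namespace Instance

open CountProgram

variable {n : ℕ} (I : Instance (Fin n))

/-- The store while cell `i` of the array `a` is computed. -/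
noncomputable def state (reg : ℕ → ℤ) (a i : ℕ) : Store :=
  ⟨reg, filled I.arrayLength I.arrayContent a i⟩

/-! ### Values of the program's expressions -/

section Eval

variable {I} {reg : ℕ → ℤ} {a i : ℕ}

theorem eval_load {b j : ℕ} {e : Expr} (he : e.eval (I.state reg a i) = j) (hb : b < a)
    (hj : j < I.arrayLength b) :
    (Expr.load b e).eval (I.state reg a i) = I.arrayContent b j :=
  filled_of_lt he hb hj

theorem eval_load_self {j : ℕ} {e : Expr} (he : e.eval (I.state reg a i) = j) (hj : j < i) :
    (Expr.load a e).eval (I.state reg a i) = I.arrayContent a j :=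
  filled_self he hj

theorem eval_load_neg {b : ℕ} {e : Expr} (he : e.eval (I.state reg a i) < 0) :
    (Expr.load b e).eval (I.state reg a i) = 0 :=
  filled_neg he

theorem eval_nE (ha : 0 < a) : nE.eval (I.state reg a i) = n :=
  (eval_load (j := 0) rfl ha (by simp [arrayLength])).trans I.encode_getD_zero

theorem eval_startE (ha : 0 < a) : startE.eval (I.state reg a i) = ((I.start : ℕ) : ℤ) :=
  (eval_load (j := 1) rfl ha (by simp only [arrayLength]; omega)).trans I.encode_getD_one

theorem eval_multE (ha : 0 < a) {e f : Expr} {v w : ℕ} (he : e.eval (I.state reg a i) = v)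
    (hf : f.eval (I.state reg a i) = w) (hv : v < n) (hw : w < n) :
    (multE e f).eval (I.state reg a i) = I.graph.mult (I.node v, I.node w) := by
  have := index_lt hv hw
  refine (eval_load (j := 2 + v * n + w) ?_ ha ?_).trans (I.encode_getD_mult hv hw)
  · simp [Expr.eval, he, hf, eval_nE ha]
  · simp only [arrayLength]
    omega

theorem eval_priorityE (ha : 0 < a) {e f : Expr} {v w : ℕ} (he : e.eval (I.state reg a i) = v)
    (hf : f.eval (I.state reg a i) = w) (hv : v < n) (hw : w < n) :
    (priorityE e f).eval (I.state reg a i) =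
      if (I.node v, I.node w) ∈ I.priority then 1 else 0 := by
  have := index_lt hv hw
  refine (eval_load (j := 2 + n * n + v * n + w) ?_ ha ?_).trans (I.encode_getD_priority hv hw)
  · simp [Expr.eval, he, hf, eval_nE ha]
  · simp only [arrayLength]
    omega

theorem eval_rowE (ha : 0 < a) (h1 : (Expr.reg 1).eval (I.state reg a i) = i) :
    rowE.eval (I.state reg a i) = ((i / n : ℕ) : ℤ) := by
  rw [rowE, Expr.eval_div, eval_nE ha, h1]
  rfl

theorem eval_colE (ha : 0 < a) (h1 : (Expr.reg 1).eval (I.state reg a i) = i) :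
    colE.eval (I.state reg a i) = ((i % n : ℕ) : ℤ) := by
  rw [colE, Expr.eval_sub, Expr.eval_mul, eval_nE ha, eval_rowE ha h1, h1]
  push_cast
  rw [Int.emod_def]

theorem eval_nn (ha : 0 < a) : (Expr.mul nE nE).eval (I.state reg a i) = ((n * n : ℕ) : ℤ) := by
  rw [Expr.eval_mul, eval_nE ha, Nat.cast_mul]

theorem eval_powE (ha : 0 < a) (h1 : (Expr.reg 1).eval (I.state reg a i) = i) :
    powE.eval (I.state reg a i) = ((i / (n * n) : ℕ) : ℤ) := by
  rw [powE, Expr.eval_div, eval_nn ha, h1]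
  rfl

theorem eval_succ_n (ha : 0 < a) :
    (Expr.add nE (.const 1)).eval (I.state reg a i) = ((n + 1 : ℕ) : ℤ) := by
  rw [Expr.eval_add, eval_nE ha]
  push_cast
  rfl

theorem eval_prevE {j : ℕ} (h1 : (Expr.reg 1).eval (I.state reg a i) = ((j + 1 : ℕ) : ℤ)) :
    prevE.eval (I.state reg a i) = j := by
  rw [prevE, Expr.eval_sub, h1, Expr.eval_const]
  push_cast
  ring

theorem eval_prevE_neg (h1 : (Expr.reg 1).eval (I.state reg a i) = ((0 : ℕ) : ℤ)) :
    prevE.eval (I.state reg a i) < 0 := by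
  rw [prevE, Expr.eval_sub, h1, Expr.eval_const]
  norm_num

theorem node_eq_start_iff {v : ℕ} (hv : v < n) : ((v : ℤ) = ((I.start : ℕ) : ℤ)) ↔
    I.node v = I.start := by
  rw [Nat.cast_inj, Fin.ext_iff, I.val_node hv]

end Eval

/-! ### Correctness of the phases -/

section Valid

theorem n_le_iterationBound : n ≤ I.iterationBound := I.le_size.trans I.size_le_iterationBound

/-- Array 0 is excluded because it is input and never filled; its length may exceed the bound. The
cubic bound is needed for array 8, which stores `n + 1` matrices. -/
theorem arrayLength_le {a : ℕ} (ha : 1 ≤ a) : I.arrayLength a ≤ I.iterationBound := by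
  have hn := I.le_size
  have h1 := I.one_le_size
  have hnn : n * n ≤ I.size ^ 2 := by nlinarith
  have h12 : I.size ≤ I.size ^ 2 := Nat.le_self_pow (by norm_num) _
  have h2 := I.size_pow_le (k := 2) (by norm_num)
  have hS := I.size_le_iterationBound
  match a with
  | 1 | 2 | 3 | 5 | 6 | 9 | 10 | 11 | 13 => simp only [arrayLength]; omega
  | 4 | 7 | 14 => simp only [arrayLength]; omega
  | 8 =>
    simp only [arrayLength]
    calc (n + 1) * (n * n) ≤ (I.size + I.size) * (I.size ^ 2) := by gcongr
      _ = I.iterationBound := by rw [iterationBound]; ring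
  | 12 =>
    have := I.sum_freeDegree_le_size
    simp only [arrayLength]
    omega
  | _ + 15 => simp [arrayLength]

/-- `Phase.Valid` for the bounds of the instance. -/
def PhaseValid (ph : Phase) (a : ℕ) : Prop :=
  ph.Valid I.arrayLength I.arrayContent I.valueBound I.iterationBound a

variable {I}

theorem phaseValid_plain {bound value : Expr} {a : ℕ} (ha : 1 ≤ a)
    (hb : ∀ reg i, bound.eval (I.state reg a i) = I.arrayLength a)
    (hv : ∀ (reg : ℕ → ℤ) (i : ℕ), i < I.arrayLength a →
      (Expr.reg 1).eval (I.state reg a i) = i →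
      value.eval (I.state reg a i) = I.arrayContent a i) :
    I.PhaseValid (plain bound value) a :=
  ⟨fun _ => 0, fun _ _ => 0, I.arrayLength_le ha, fun _ _ => Nat.zero_le _,
    fun reg i _ => hb reg i, fun _ _ _ _ => rfl, fun _ _ _ _ _ _ _ => rfl,
    fun reg i hi h _ => hv reg i hi h, fun _ _ => ⟨0, by simp, by simp⟩⟩

theorem phaseValid_nodeSum {bound summand : Expr} {a : ℕ} (ha : 1 ≤ a) {ev : ℕ → ℕ → ℤ} {T : ℕ}
    (hb : ∀ reg i, bound.eval (I.state reg a i) = I.arrayLength a)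
    (hv : ∀ (reg : ℕ → ℤ) (i l : ℕ), i < I.arrayLength a → l < n →
      (Expr.reg 1).eval (I.state reg a i) = i → (Expr.reg 2).eval (I.state reg a i) = l →
      summand.eval (I.state reg a i) = ev i l)
    (hs : ∀ i < I.arrayLength a, ∑ l ∈ Finset.range n, ev i l = I.arrayContent a i)
    (hT : ∀ i < I.arrayLength a, ∀ l < n, |ev i l| ≤ T) (hB : n * T ≤ I.valueBound) :
    I.PhaseValid (nodeSum bound summand) a :=
  ⟨fun _ => n, ev, I.arrayLength_le ha, fun _ _ => I.n_le_iterationBound,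
    fun reg i _ => hb reg i, fun _ _ _ _ => eval_nE ha,
    fun reg i l hi hl h h' => hv reg i l hi hl h h',
    fun _ i hi _ h3 => h3.trans (hs i hi), fun i hi => ⟨T, hT i hi, hB⟩⟩

variable (I)

theorem mul_size_le_valueBound (I : Instance (Fin n)) : n * I.size ≤ I.valueBound := by
  refine I.le_valueBound_of_le ?_
  have := I.size_pow_le (k := 2) (by norm_num)
  have := I.le_size
  nlinarith

theorem abs_cast_le_size {x : ℕ} (hx : x ≤ I.size) : |(x : ℤ)| ≤ (I.size : ℤ) := by
  rw [Nat.abs_cast]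
  exact_mod_cast hx

theorem excessPhase_valid : I.PhaseValid excessPhase 1 := by
  refine phaseValid_nodeSum le_rfl (T := I.size)
    (ev := fun i l => (I.graph.mult (I.node i, I.node l) : ℤ) - I.graph.mult (I.node l, I.node i))
    (fun _ _ => eval_nE one_pos) ?_ ?_ ?_ I.mul_size_le_valueBound
  · intro reg i l hi hl h1 h2
    rw [Expr.eval_sub, eval_multE one_pos h1 h2 hi hl, eval_multE one_pos h2 h1 hl hi]
  · intro i _
    exact I.sum_range_node fun w => (I.graph.mult (I.node i, w) : ℤ) - I.graph.mult (w, I.node i)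
  · intro i _ l _
    exact I.abs_excess_summand_le _ _

theorem imbalancePhase_valid : I.PhaseValid imbalancePhase 2 := by
  refine phaseValid_nodeSum (by norm_num) (T := n * I.size * (n * I.size))
    (ev := fun _ l => I.excess (I.node l) * I.excess (I.node l)) (fun _ _ => rfl) ?_ ?_ ?_ ?_
  · intro reg i l _ hl _ h2
    rw [Expr.eval_mul, eval_load (b := 1) (j := l) h2 (by norm_num) hl]
    rfl
  · intro i _
    exact I.sum_range_node fun v => I.excess v * I.excess v
  · intro i _ l _
    rw [abs_mul, Nat.cast_mul]
    exact mul_le_mul (I.abs_excess_le _) (I.abs_excess_le _) (abs_nonneg _) (by positivity)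
  · have hSS : n * I.size ≤ I.iterationBound := by
      have := I.size_pow_le (k := 2) (by norm_num)
      have := I.le_size
      nlinarith
    refine I.le_valueBound (e := 3) ?_ (by omega)
    calc n * (n * I.size * (n * I.size)) ≤
          I.iterationBound * (I.iterationBound * I.iterationBound) := by
          gcongr
          exact I.n_le_iterationBound
      _ = _ := by ring

theorem residualDegreePhase_valid : I.PhaseValid residualDegreePhase 3 := by
  refine phaseValid_nodeSum (by norm_num) (T := I.size)
    (ev := fun i l => (I.residual.mult (I.node i, I.node l) : ℤ))
    (fun _ _ => eval_nE (by norm_num)) ?_ ?_ ?_ I.mul_size_le_valueBound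
  · intro reg i l hi hl h1 h2
    rw [Expr.eval_mul, Expr.eval_sub, eval_multE (by norm_num) h1 h2 hi hl,
      eval_priorityE (by norm_num) h1 h2 hi hl, residual_mult, Expr.eval_const]
    split_ifs <;> simp
  · intro i _
    rw [arrayContent, DirectedMultigraph.outDegree_eq_sum,
      I.sum_range_node (fun w => (I.residual.mult (I.node i, w) : ℤ)), Nat.cast_sum]
  · intro i _ l _
    exact I.abs_cast_le_size ((I.residual_mult_le _).trans (I.mult_le_size _ _))

theorem freeMultPhase_valid : I.PhaseValid freeMultPhase 4 := by
  refine phaseValid_plain (by norm_num) (fun _ _ => eval_nn (by norm_num)) ?_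
  intro reg i hi h1
  have hi : i < n * n := hi
  have hn := I.one_le_n
  have hr : i / n < n := Nat.div_lt_of_lt_mul hi
  have hc : i % n < n := Nat.mod_lt _ hn
  have hrow := eval_rowE (I := I) (a := 4) (by norm_num) h1
  have hcol := eval_colE (I := I) (a := 4) (by norm_num) h1
  rw [Expr.eval_mul, Expr.eval_sub, Expr.eval_mul, Expr.eval_const, Expr.eval_nonzero,
    eval_multE (by norm_num) hrow hcol hr hc, eval_priorityE (by norm_num) hrow hcol hr hc,
    eval_load (b := 3) hrow (by norm_num) hr]
  simp only [arrayContent, freeMult, Nat.cast_eq_zero]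
  rw [residual_mult]
  split_ifs <;> simp

theorem arrayContent_four {v w : ℕ} (hw : w < n) :
    I.arrayContent 4 (v * n + w) = I.freeMult (I.node v) (I.node w) := by
  have h1 : (v * n + w) / n = v := by
    rw [mul_comm, Nat.mul_add_div (by omega), Nat.div_eq_of_lt hw, add_zero]
  have h2 : (v * n + w) % n = w := by
    rw [mul_comm, Nat.mul_add_mod, Nat.mod_eq_of_lt hw]
  rw [arrayContent, h1, h2]

theorem arrayContent_seven {v w : ℕ} (hw : w < n) :
    I.arrayContent 7 (v * n + w) = (-I.exitLaplacian) (I.node v) (I.node w) := by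
  have h1 : (v * n + w) / n = v := by
    rw [mul_comm, Nat.mul_add_div (by omega), Nat.div_eq_of_lt hw, add_zero]
  have h2 : (v * n + w) % n = w := by
    rw [mul_comm, Nat.mul_add_mod, Nat.mod_eq_of_lt hw]
  rw [arrayContent, h1, h2]

theorem arrayContent_eight {k v w : ℕ} (hv : v < n) (hw : w < n) :
    I.arrayContent 8 (k * (n * n) + v * n + w) =
      ((-I.exitLaplacian) ^ k) (I.node v) (I.node w) := by
  have h0 : k * (n * n) + v * n + w = (k * n + v) * n + w := by ring
  have h1 : ((k * n + v) * n + w) / n = k * n + v := by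
    rw [mul_comm, Nat.mul_add_div (by omega), Nat.div_eq_of_lt hw, add_zero]
  have h2 : ((k * n + v) * n + w) % n = w := by
    rw [mul_comm, Nat.mul_add_mod, Nat.mod_eq_of_lt hw]
  have h3 : (k * n + v) / n = k := by
    rw [mul_comm, Nat.mul_add_div (by omega), Nat.div_eq_of_lt hv, add_zero]
  have h4 : (k * n + v) % n = v := by
    rw [mul_comm, Nat.mul_add_mod, Nat.mod_eq_of_lt hv]
  rw [arrayContent, h0, ← Nat.div_div_eq_div_mul, h1, h2, h3, h4]

theorem freeDegreePhase_valid : I.PhaseValid freeDegreePhase 5 := by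
  refine phaseValid_nodeSum (by norm_num) (T := I.size)
    (ev := fun i l => (I.freeMult (I.node i) (I.node l) : ℤ))
    (fun _ _ => eval_nE (by norm_num)) ?_ ?_ ?_ I.mul_size_le_valueBound
  · intro reg i l hi hl h1 h2
    have hi : i < n := hi
    rw [eval_load (b := 4) (j := i * n + l) ?_ (by norm_num) (index_lt hi hl), I.arrayContent_four hl]
    rw [Expr.eval_add, Expr.eval_mul, eval_nE (by norm_num), h1, h2]
    push_cast
    rfl
  · intro i _
    rw [arrayContent, freeDegree,
      I.sum_range_node (fun w => (I.freeMult (I.node i) w : ℤ)), Nat.cast_sum]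
  · intro i _ l _
    exact I.abs_cast_le_size ((I.freeMult_le _ _).trans (I.mult_le_size _ _))

theorem flagPhase_valid : I.PhaseValid flagPhase 6 := by
  refine phaseValid_plain (by norm_num) (fun _ _ => eval_nE (by norm_num)) ?_
  intro reg i hi h1
  have hi : i < n := hi
  rw [Expr.eval_mul, Expr.eval_sub, Expr.eval_const, Expr.eval_eq, Expr.eval_nonzero,
    eval_startE (by norm_num), eval_load (b := 5) (j := i) h1 (by norm_num) hi, h1]
  simp only [node_eq_start_iff hi, arrayContent, exitFlag, Nat.cast_eq_zero]
  by_cases h2 : I.node i = I.start <;> by_cases h3 : I.freeDegree (I.node i) = 0 <;> simp [h2, h3]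

theorem laplacianPhase_valid : I.PhaseValid laplacianPhase 7 := by
  refine phaseValid_plain (by norm_num) (fun _ _ => eval_nn (by norm_num)) ?_
  intro reg i hi h1
  have hi : i < n * n := hi
  have hn := I.one_le_n
  have hr : i / n < n := Nat.div_lt_of_lt_mul hi
  have hc : i % n < n := Nat.mod_lt _ hn
  have hrow := eval_rowE (I := I) (a := 7) (by norm_num) h1
  have hcol := eval_colE (I := I) (a := 7) (by norm_num) h1
  have hflag : flagE.eval (I.state reg 7 i) = I.exitFlag (I.node (i / n)) :=
    eval_load hrow (by norm_num) hr
  have hrc : ((i / n : ℕ) : ℤ) = ((i % n : ℕ) : ℤ) ↔ I.node (i / n) = I.node (i % n) := by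
    rw [Nat.cast_inj, Fin.ext_iff, I.val_node hr, I.val_node hc]
  simp only [Expr.eval_add, Expr.eval_sub, Expr.eval_mul, Expr.eval_const, Expr.eval_eq, hflag, hrow,
    hcol]
  rw [eval_startE (by norm_num), eval_load (b := 4) h1 (by norm_num) hi,
    eval_load (b := 5) hrow (by norm_num) hr]
  simp only [node_eq_start_iff hr, node_eq_start_iff hc, hrc, arrayContent, Matrix.neg_apply,
    exitLaplacian, Matrix.of_apply, sum_exitWeight, exitWeight_eq]
  by_cases h2 : I.node (i / n) = I.start
  · simp [h2]
  · simp only [h2, if_false, ne_eq, not_false_eq_true, if_true]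
    split_ifs <;> ring

end Valid

end Instance

namespace Instance

open CountProgram

variable {n : ℕ} (I : Instance (Fin n))

theorem powersPhase_valid : I.PhaseValid powersPhase 8 := by
  have hn := I.one_le_n
  have hpos : 0 < n * n := by positivity
  set X := -I.exitLaplacian with hX
  -- Indices beyond the block of the identity matrix are decomposed into exponent, row and column.
  have key : ∀ i, n * n ≤ i → ∃ k v w, v < n ∧ w < n ∧ i = (k + 1) * (n * n) + v * n + w ∧
      i / n = (k + 1) * n + v ∧ i % n = w ∧ i / (n * n) = k + 1 := by
    intro i hi
    have h1 : 1 ≤ i / (n * n) := (Nat.one_le_div_iff hpos).2 hi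
    have h3 : i / n / n = i / (n * n) := Nat.div_div_eq_div_mul _ _ _
    have h4 := Nat.div_add_mod (i / n) n
    have h5 := Nat.div_add_mod i n
    refine ⟨i / (n * n) - 1, i / n % n, i % n, Nat.mod_lt _ hn, Nat.mod_lt _ hn, ?_, ?_, rfl, ?_⟩
    · rw [Nat.sub_add_cancel h1, ← h3]
      nth_rewrite 1 [← h5]
      nth_rewrite 1 [← h4]
      ring
    · rw [Nat.sub_add_cancel h1, ← h3]
      nth_rewrite 1 [← h4]
      ring
    · rw [Nat.sub_add_cancel h1]
  have hsmall : ∀ i, ¬ n * n ≤ i → i / (n * n) = 0 := fun i hi =>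
    Nat.div_eq_of_lt (not_le.1 hi)
  refine ⟨fun i => if n * n ≤ i then n else 0,
    fun i l => (X ^ (i / (n * n) - 1)) (I.node (i / n % n)) (I.node l) *
      X (I.node l) (I.node (i % n)), I.arrayLength_le (by norm_num), ?_, ?_, ?_, ?_, ?_, ?_⟩
  · intro i _
    dsimp only
    split_ifs
    · exact I.n_le_iterationBound
    · exact Nat.zero_le _
  · intro reg i _
    refine (congrArg₂ (· * ·) (eval_succ_n (I := I) (reg := reg) (i := i) (a := 8) (by norm_num))
      (eval_nn (by norm_num))).trans ?_
    simp only [arrayLength]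
    push_cast
    rfl
  · intro reg i _ h1
    refine (congrArg₂ (· * ·) (eval_nE (I := I) (reg := reg) (i := i) (a := 8) (by norm_num))
      (congrArg₂ (· - ·) rfl (Expr.eval_eq _ powE (.const 0)))).trans ?_
    have h2 : powE.eval ⟨reg, filled I.arrayLength I.arrayContent 8 i⟩ = _ :=
      eval_powE (I := I) (by norm_num) h1
    simp only [h2, Expr.eval_const]
    by_cases hi : n * n ≤ i
    · obtain ⟨k, v, w, -, -, -, -, -, h⟩ := key i hi
      rw [if_pos hi, h, if_neg (by push_cast; omega)]
      simp
    · rw [if_neg hi, hsmall i hi]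
      simp
  · intro reg i l hi0 hl h1 h2
    dsimp only at hl
    have hi : n * n ≤ i := by
      by_contra h
      rw [if_neg h] at hl
      omega
    rw [if_pos hi] at hl
    obtain ⟨k, v, w, hv, hw, h3, h4, h5, h6⟩ := key i hi
    have h7 : i / n % n = v := by rw [h4, mul_comm, Nat.mul_add_mod, Nat.mod_eq_of_lt hv]
    change (Expr.mul _ _).eval (I.state reg 8 i) = _
    beta_reduce
    have hrow := eval_rowE (I := I) (a := 8) (by norm_num) h1
    have hcol := eval_colE (I := I) (a := 8) (by norm_num) h1
    have hl2 : (Expr.reg 2).eval (I.state reg 8 i) = l := h2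
    rw [Expr.eval_mul, eval_load_self (j := k * (n * n) + v * n + l),
      eval_load (b := 7) (j := l * n + w), I.arrayContent_eight hv hl, I.arrayContent_seven hw,
      h6, h7, h5, Nat.add_sub_cancel]
    · rw [Expr.eval_add, Expr.eval_mul, hl2, eval_nE (by norm_num), hcol, h5]
      push_cast
      rfl
    · norm_num
    · exact index_lt hl hw
    · rw [Expr.eval_add, Expr.eval_sub, Expr.eval_mul, eval_nn (by norm_num), hl2,
        eval_nE (by norm_num), hrow, h4]
      push_cast
      ring
    · rw [h3, add_mul]
      have : l < n * n := hl.trans_le (Nat.le_mul_self n)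
      omega
  · intro reg i hi0 h1 h3
    have hi0 : i < (n + 1) * (n * n) := hi0
    change (Expr.add _ _).eval (I.state reg 8 i) = _
    have h3 : (Expr.reg 3).eval (I.state reg 8 i) = _ := h3
    beta_reduce at h3
    have hrow := eval_rowE (I := I) (a := 8) (by norm_num) h1
    have hcol := eval_colE (I := I) (a := 8) (by norm_num) h1
    have hpow := eval_powE (I := I) (a := 8) (by norm_num) h1
    rw [Expr.eval_add, Expr.eval_mul, Expr.eval_eq, Expr.eval_eq, hrow, hcol, hpow, h3,
      Expr.eval_const]
    by_cases hi : n * n ≤ i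
    · obtain ⟨k, v, w, hv, hw, h3, h4, h5, h6⟩ := key i hi
      have h7 : i / n % n = v := by rw [h4, mul_comm, Nat.mul_add_mod, Nat.mod_eq_of_lt hv]
      rw [if_pos hi, h6, if_neg (by push_cast; omega), zero_mul, add_zero, Nat.add_sub_cancel,
        h7, h5, I.sum_range_node (fun l => (X ^ k) (I.node v) l * X l (I.node w)),
        ← Matrix.mul_apply, ← pow_succ, arrayContent, h6, h7, h5]
    · have hr : i / n < n := Nat.div_lt_of_lt_mul (not_le.1 hi)
      have hc : i % n < n := Nat.mod_lt _ hn
      rw [if_neg hi, hsmall i hi, arrayContent, hsmall i hi, pow_zero, Nat.mod_eq_of_lt hr,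
        Matrix.one_apply]
      simp only [Nat.cast_inj, Fin.ext_iff, I.val_node hr, I.val_node hc]
      simp
  · intro i hi0
    have hi0 : i < (n + 1) * (n * n) := hi0
    -- A bound for powers up to the `n`-th times a bound for the entries; with `n` summands the
    -- total stays below `iterationBound ^ (n + 1)`.
    refine ⟨I.iterationBound ^ n * (2 * I.size), fun l hl => ?_, ?_⟩
    · dsimp only at hl
      have hi : n * n ≤ i := by
        by_contra h
        rw [if_neg h] at hl
        omega
      have h2 : i / (n * n) < n + 1 := Nat.div_lt_of_lt_mul (by rw [mul_comm]; exact hi0)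
      rw [abs_mul, Nat.cast_mul]
      refine mul_le_mul ((I.abs_powers_le _ _ _).trans ?_) (I.abs_neg_exitLaplacian_le _ _)
        (abs_nonneg _) (by positivity)
      exact_mod_cast Nat.pow_le_pow_right I.pos_iterationBound (by omega)
    · have hS3 : I.size ≤ I.size ^ 3 := Nat.le_self_pow (by norm_num) _
      have h1 := I.le_size
      have h2 := pow_one (n * (2 * I.size)) ▸ I.pow_card_mul_le 1
      refine I.le_valueBound (e := n + 1) ?_ (by omega)
      dsimp only
      calc (if n * n ≤ i then n else 0) * (I.iterationBound ^ n * (2 * I.size))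
          ≤ n * (I.iterationBound ^ n * (2 * I.size)) := by
            gcongr
            split_ifs <;> omega
        _ = I.iterationBound ^ n * (n * (2 * I.size)) := by ring
        _ ≤ I.iterationBound ^ n * I.iterationBound := by
            gcongr
            simpa using h2
        _ = _ := (pow_succ _ _).symm

theorem tracesPhase_valid : I.PhaseValid tracesPhase 9 := by
  refine phaseValid_nodeSum (by norm_num) (T := I.iterationBound ^ n)
    (ev := fun i l => ((-I.exitLaplacian) ^ i) (I.node l) (I.node l))
    (fun _ _ => eval_succ_n (by norm_num)) ?_ ?_ ?_ ?_
  · intro reg i l hi hl h1 h2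
    have hi : i < n + 1 := hi
    rw [eval_load (b := 8) (j := i * (n * n) + l * n + l), I.arrayContent_eight hl hl]
    · rw [Expr.eval_add, Expr.eval_add, Expr.eval_mul, eval_nn (by norm_num), Expr.eval_mul,
        eval_nE (by norm_num), h1, h2]
      push_cast
      rfl
    · norm_num
    · simp only [arrayLength]
      have h3 := index_lt hl hl
      calc i * (n * n) + l * n + l < i * (n * n) + n * n := by omega
        _ = (i + 1) * (n * n) := by ring
        _ ≤ _ := Nat.mul_le_mul_right _ hi
  · intro i _
    exact I.sum_range_node fun v => ((-I.exitLaplacian) ^ i) v v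
  · intro i hi l _
    have hi : i < n + 1 := hi
    refine (I.abs_powers_le _ _ _).trans ?_
    exact_mod_cast Nat.pow_le_pow_right I.pos_iterationBound (by omega)
  · have hS3 : I.size ≤ I.size ^ 3 := Nat.le_self_pow (by norm_num) _
    have h1 := I.le_size
    refine I.le_valueBound (e := n + 1) ?_ (by omega)
    rw [pow_succ']
    exact Nat.mul_le_mul_right _ I.n_le_iterationBound

theorem coeffsPhase_valid : I.PhaseValid coeffsPhase 10 := by
  set X := -I.exitLaplacian with hX
  refine ⟨fun i => i, fun i l => X.charpoly.coeff (n - (i - 1 - l)) * (X ^ (l + 1)).trace,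
    I.arrayLength_le (by norm_num), ?_, ?_, ?_, ?_, ?_, ?_⟩
  · intro i hi
    exact hi.le.trans (I.arrayLength_le (by norm_num))
  · intro reg i _
    exact eval_succ_n (I := I) (by norm_num)
  · intro reg i _ h1
    exact h1
  · intro reg i l hi hl h1 h2
    have hi : i < n + 1 := hi
    have hl : l < i := hl
    change (Expr.mul _ _).eval (I.state reg 10 i) = _
    have h1 : (Expr.reg 1).eval (I.state reg 10 i) = i := h1
    have h2 : (Expr.reg 2).eval (I.state reg 10 i) = l := h2
    obtain ⟨j, rfl⟩ : ∃ j, i = j + 1 := ⟨i - 1, by omega⟩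
    rw [Expr.eval_mul, eval_load_self (j := j - l), eval_load (b := 9) (j := l + 1)]
    · rfl
    · rw [Expr.eval_add, h2, Expr.eval_const]
      push_cast
      rfl
    · norm_num
    · simp only [arrayLength]
      omega
    · rw [Expr.eval_sub, eval_prevE h1, h2]
      omega
    · omega
  · intro reg i hi h1 h3
    have hi : i < n + 1 := hi
    change (Expr.add _ _).eval (I.state reg 10 i) = _
    have h1 : (Expr.reg 1).eval (I.state reg 10 i) = i := h1
    have h3 : (Expr.reg 3).eval (I.state reg 10 i) = _ := h3
    beta_reduce at h3
    rw [Expr.eval_add, Expr.eval_eq, Expr.eval_div, Expr.eval_sub, h1, h3, Expr.eval_const]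
    cases i with
    | zero =>
      have h := X.charpoly_monic.coeff_natDegree
      rw [Matrix.charpoly_natDegree_eq_dim, Fintype.card_fin] at h
      simp [arrayContent, ← hX, h]
    | succ j =>
      have h := newton_charpoly X j (by rw [Fintype.card_fin]; omega)
      rw [Fintype.card_fin] at h
      rw [if_neg (by push_cast; omega), zero_add, zero_sub]
      simp only [Nat.add_sub_cancel]
      -- By Newton's identity the numerator is a multiple of `j + 1`, so the integer division is
      -- exact.
      rw [← h, Int.mul_ediv_cancel_left _ (by positivity)]
      rfl
  · intro i hi
    have hi : i < n + 1 := hi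
    refine ⟨I.iterationBound ^ i, fun l hl => ?_, ?_⟩
    · have hl : l < i := hl
      rw [abs_mul]
      calc _ ≤ ((I.iterationBound ^ (i - 1 - l) : ℕ) : ℤ) *
            ((I.iterationBound ^ (l + 1) : ℕ) : ℤ) :=
            mul_le_mul (I.abs_coeffs_le (by omega)) (I.abs_traces_succ_le l) (abs_nonneg _)
              (by positivity)
        _ = _ := by
          rw [← Nat.cast_mul, ← pow_add]
          congr 2
          omega
    · have hS3 : I.size ≤ I.size ^ 3 := Nat.le_self_pow (by norm_num) _
      have h1 := I.le_size
      refine I.le_valueBound (e := i + 1) ?_ (by omega)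
      rw [pow_succ']
      exact Nat.mul_le_mul_right _ ((by omega : i ≤ I.size).trans I.size_le_iterationBound)

theorem totalPhase_valid : I.PhaseValid totalPhase 11 := by
  refine phaseValid_nodeSum (by norm_num) (T := I.size)
    (ev := fun _ l => (I.freeDegree (I.node l) : ℤ)) (fun _ _ => rfl) ?_ ?_ ?_
    I.mul_size_le_valueBound
  · intro reg i l _ hl _ h2
    exact eval_load (b := 5) h2 (by norm_num) hl
  · intro i _
    exact I.sum_range_node fun v => (I.freeDegree v : ℤ)
  · intro i _ l _
    exact I.abs_cast_le_size (I.freeDegree_le_size _)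

theorem factorialPhase_valid : I.PhaseValid factorialPhase 12 := by
  refine phaseValid_plain (by norm_num) ?_ ?_
  · intro reg i
    rw [Expr.eval_add, eval_load (b := 11) (j := 0) rfl (by norm_num) (by simp [arrayLength]),
      Expr.eval_const]
    simp [arrayContent, arrayLength]
  · intro reg i hi h1
    rw [Expr.eval_add, Expr.eval_mul, Expr.eval_eq, h1, Expr.eval_const]
    cases i with
    | zero => simp [arrayContent]
    | succ j =>
      rw [eval_load_self (eval_prevE h1) (Nat.lt_succ_self j), if_neg (by push_cast; omega),
        zero_add]
      simp only [arrayContent, Nat.factorial_succ]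
      push_cast
      rfl

variable {I} in
theorem eval_factorial {reg : ℕ → ℤ} {a i j : ℕ} {e : Expr} (ha : 12 < a)
    (he : e.eval (I.state reg a i) = j) (hj : j ≤ ∑ v, I.freeDegree v) :
    (Expr.load 12 e).eval (I.state reg a i) = j.factorial :=
  eval_load (b := 12) he ha (Nat.lt_succ_of_le hj)

theorem freeDegree_le_sum (v : Fin n) : I.freeDegree v ≤ ∑ v, I.freeDegree v :=
  Finset.single_le_sum (f := I.freeDegree) (fun _ _ => Nat.zero_le _) (Finset.mem_univ v)

theorem exitFlag_le (v : Fin n) : I.exitFlag v ≤ I.freeDegree v := by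
  rw [exitFlag]
  split_ifs with h
  · exact Nat.zero_le _
  · omega

theorem numeratorPhase_valid : I.PhaseValid numeratorPhase 13 := by
  refine phaseValid_plain (by norm_num) (fun _ _ => eval_succ_n (by norm_num)) ?_
  intro reg i hi h1
  have hi : i < n + 1 := hi
  rw [Expr.eval_add, Expr.eval_mul, Expr.eval_eq, h1, Expr.eval_const]
  cases i with
  -- In cell 0 the previous index is `-1`, where every array reads 0, so only the indicator
  -- contributes.
  | zero => rw [eval_load_neg (eval_prevE_neg h1)]; simp [arrayContent]
  | succ j =>
    have hp := eval_prevE (I := I) (a := 13) h1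
    have hj : j < n := by omega
    rw [eval_load_self hp (Nat.lt_succ_self j), if_neg (by push_cast; omega), zero_add,
      eval_factorial (j := I.freeDegree (I.node j) - I.exitFlag (I.node j)) (by norm_num)]
    · simp only [arrayContent, Finset.prod_range_succ]
    · rw [Expr.eval_sub, eval_load (b := 5) hp (by norm_num) hj,
        eval_load (b := 6) hp (by norm_num) hj, Nat.cast_sub (I.exitFlag_le _)]
      rfl
    · exact (Nat.sub_le _ _).trans (I.freeDegree_le_sum _)

theorem denominatorPhase_valid : I.PhaseValid denominatorPhase 14 := by
  refine phaseValid_plain (by norm_num) (fun reg i => ?_) ?_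
  · rw [Expr.eval_add, eval_nn (by norm_num), Expr.eval_const]
    simp [arrayLength]
  intro reg i hi h1
  have hi : i < n * n + 1 := hi
  rw [Expr.eval_add, Expr.eval_mul, Expr.eval_eq, h1, Expr.eval_const]
  cases i with
  | zero => rw [eval_load_neg (eval_prevE_neg h1)]; simp [arrayContent]
  | succ j =>
    have hp := eval_prevE (I := I) (a := 14) h1
    have hj : j < n * n := by omega
    rw [eval_load_self hp (Nat.lt_succ_self j), if_neg (by push_cast; omega), zero_add,
      eval_factorial (j := I.freeMult (I.node (j / n)) (I.node (j % n))) (by norm_num)]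
    · simp only [arrayContent, Finset.prod_range_succ]
    · exact eval_load (b := 4) hp (by norm_num) hj
    · exact (Finset.single_le_sum (f := fun w => I.freeMult (I.node (j / n)) w)
        (fun _ _ => Nat.zero_le _) (Finset.mem_univ _)).trans (I.freeDegree_le_sum _)

theorem phases_valid :
    PhasesValid I.arrayLength I.arrayContent I.valueBound I.iterationBound 1 phases :=
  ⟨I.excessPhase_valid, I.imbalancePhase_valid, I.residualDegreePhase_valid, I.freeMultPhase_valid,
    I.freeDegreePhase_valid, I.flagPhase_valid, I.laplacianPhase_valid, I.powersPhase_valid,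
    I.tracesPhase_valid, I.coeffsPhase_valid, I.totalPhase_valid, I.factorialPhase_valid,
    I.numeratorPhase_valid, I.denominatorPhase_valid, trivial⟩

/-! ### The result of the program and its running time -/

/-- Array 0 counts as filled from the start, so the input store is the state before cell 0 of array
1. -/
theorem init_encode : Store.init I.encode = I.state (fun _ => 0) 1 0 := by
  have h : ∀ a z, (if a = 0 ∧ 0 ≤ z then I.encode.getD z.toNat 0 else 0) =
      filled I.arrayLength I.arrayContent 1 0 a z := by
    intro a z
    by_cases ha : a = 0
    · subst ha
      simp only [filled, arrayContent, arrayLength]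
      by_cases hz : 0 ≤ z
      · by_cases hl : z.toNat < 2 + n * n + n * n
        · simp [hz, hl]
        · rw [List.getD_eq_default _ _ (by rw [length_encode]; omega)]
          simp
      · simp [hz]
    · simp [filled, ha]
  simp only [Store.init, state, h]

theorem det_exitLaplacian : I.exitLaplacian.det = (-I.exitLaplacian).charpoly.coeff 0 := by
  have h := Matrix.det_eq_sign_charpoly_coeff (-I.exitLaplacian)
  rw [Matrix.det_neg] at h
  exact mul_left_cancel₀ (pow_ne_zero _ (by norm_num)) h

theorem eval_resultE (reg : ℕ → ℤ) : resultE.eval (I.state reg 15 0) = I.count := by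
  have h2 : (Expr.load 2 (.const 0)).eval (I.state reg 15 0) = ∑ v, I.excess v * I.excess v :=
    eval_load (b := 2) (j := 0) rfl (by norm_num) (by simp [arrayLength])
  have h13 : (Expr.load 13 nE).eval (I.state reg 15 0) =
      ∏ v, ((I.freeDegree v - I.exitFlag v).factorial : ℤ) :=
    (eval_load (b := 13) (eval_nE (by norm_num)) (by norm_num) (Nat.lt_succ_self n)).trans
      (I.prod_range_node fun v => ((I.freeDegree v - I.exitFlag v).factorial : ℤ))
  have h10 : (Expr.load 10 nE).eval (I.state reg 15 0) = I.exitLaplacian.det := by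
    rw [eval_load (b := 10) (eval_nE (by norm_num)) (by norm_num) (Nat.lt_succ_self n),
      det_exitLaplacian, arrayContent, Nat.sub_self]
  have h14 : (Expr.load 14 (.mul nE nE)).eval (I.state reg 15 0) =
      ∏ v, ∏ w, ((I.freeMult v w).factorial : ℤ) :=
    (eval_load (b := 14) (eval_nn (by norm_num)) (by norm_num) (Nat.lt_succ_self _)).trans
      (I.prod_range_node_node fun v w => ((I.freeMult v w).factorial : ℤ))
  rw [resultE, Expr.eval_mul, Expr.eval_sub, Expr.eval_div, Expr.eval_mul, Expr.eval_const,
    Expr.eval_nonzero, h2, h13, h10, h14]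
  by_cases hb : I.graph.Balanced
  · have h := I.count_mul_prod_factorial_eq_det hb
    have hprod : ∀ v, ((I.freeDegree v - I.exitFlag v).factorial : ℤ) =
        if v = I.start then ((I.freeDegree v).factorial : ℤ)
        else ((I.freeDegree v - 1).factorial : ℤ) := by
      intro v
      rw [exitFlag]
      by_cases hv : v = I.start
      · simp [hv]
      · by_cases hd : I.freeDegree v = 0 <;> simp [hv, hd]
    have hne : ∏ v, ∏ w, ((I.freeMult v w).factorial : ℤ) ≠ 0 :=
      Finset.prod_ne_zero_iff.2 fun v _ => Finset.prod_ne_zero_iff.2 fun w _ =>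
        Nat.cast_ne_zero.2 (Nat.factorial_ne_zero _)
    rw [if_pos (I.excess_sq_eq_zero_iff.2 hb), sub_zero, one_mul, Finset.prod_congr rfl fun v _ => hprod v, ← h,
      Int.mul_ediv_cancel _ hne]
  · rw [if_neg (mt I.excess_sq_eq_zero_iff.1 hb), I.count_eq_zero_of_not_balanced hb]
    simp

theorem polyTimeComputable_count :
    PolyTimeComputable (α := Σ n : ℕ, Instance (Fin n)) (fun I => I.2.encode)
      (fun I => I.2.size) (fun I => (I.2.count : ℤ)) := by
  obtain ⟨C, hC⟩ := exec_runPhases phases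
  set D := resultE.costFactor + resultE.growth + 1 with hD
  -- The polynomial is `C * (M + 1) ^ 2 * K + D * K` with `M = iterationBound` and `K = lengthBound`
  -- written out in the size; the second term pays for the final assignment.
  refine ⟨program, .C C * (2 * .X ^ 3 + 1) ^ 2 * (2 * .X ^ 3 * (.X ^ 3 + 3) + 1) +
    .C D * (2 * .X ^ 3 * (.X ^ 3 + 3) + 1), ?_⟩
  rintro ⟨n, I⟩
  have hBK : ∀ z : ℤ, |z| ≤ (I.valueBound : ℤ) → bitLength z ≤ I.lengthBound := fun z hz =>
    I.bitLength_le_lengthBound hz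
  obtain ⟨reg, c, hc, hreg, hc'⟩ := hC I.arrayLength I.arrayContent 1 I.valueBound I.lengthBound
    I.iterationBound hBK I.arrayContent_le (I.le_valueBound_of_le le_rfl) I.phases_valid
    (fun _ => 0) (fun _ => by simp)
  have hfits : (I.state reg 15 0).Fits I.lengthBound := by
    refine fits_mk hBK hreg fun b j => ?_
    simp only [filled]
    split_ifs with h
    · refine I.arrayContent_le _ _ ?_
      rcases h.2 with h | h
      · exact h.2
      · omega
    · simp
  obtain ⟨c2, hc2, hc2'⟩ := Exec.assign_le hfits (Nat.le_add_left _ _) 0 resultE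
    (I.eval_resultE reg)
  refine ⟨_, c + c2, .seq (P := runPhases 1 phases) (s' := I.state reg 15 0) ?_ hc2, ?_, ?_⟩
  · dsimp only
    rw [init_encode]
    exact hc
  · simp [Store.setReg]
  · rw [← hD] at hc2'
    refine (add_le_add hc' hc2').trans_eq ?_
    simp [iterationBound, lengthBound]

end Instance

end ECP

theorem mainTheorem4 :
    -- the number of solutions is computable in polynomial time, on all instances
    ECP.PolyTimeComputable (α := Σ n : ℕ, ECP.Instance (Fin n))
      (fun I => I.2.encode) (fun I => I.2.size) (fun I => (I.2.count : ℤ)) ∧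
    ∀ {V : Type*} [Fintype V] [DecidableEq V] (I : ECP.Instance V),
      -- the modified BEST formula
      (I.graph.Balanced → (∀ v, (I.residual.outEdges v).Nonempty) →
        (I.count : ℚ) = I.bestFormula) ∧
      (¬ I.graph.Balanced → I.count = 0) ∧
      -- its last factor is a determinant
      (I.residual.weightedTreeCount I.start : ℤ) =
        (I.residual.reducedLaplacian I.start).det := by
  refine ⟨ECP.Instance.polyTimeComputable_count, fun I => ⟨I.count_eq_bestFormula,
    I.count_eq_zero_of_not_balanced, I.residual.weightedTreeCount_eq_det I.start⟩⟩
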